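/- Let $\mathbb{K}$ be a field of characteristic zero and write $[n]=\{1,\dots,n\}$. \textbf{Tableaux.} For a partition $\lambda\vdash n$ let $D_\lambda=\{(i,j):1\le j\le\lambda_i\}$ be its Young diagram ($i$ is the row, $j$ the column). A Young tableau of shape $\lambda$ with set of entries $A$ is a bijection $T:D_\lambda\to A$. Its row (resp. column) subgroup $\mathcal{R}_T$ (resp. $\mathcal{C}_T$) is the group of permutations of $A$ mapping each row (resp. column) of $T$ to itself, and its Young symmetrizer is \[\mathfrak{c}_\lambda(T)=\Big(\sum_{\sigma\in\mathcal{R}_T}\sigma\Big)\cdot\Big(\sum_{\tau\in\mathcal{C}_T}\mathrm{sgn}(\tau)\,\tau\Big)\in\mathbb{K}[\mathfrak{S}_A].\] \textbf{The generic tensor algebra.} Let $\mathscr{T}$ be the functor from finite sets with bijections to $\mathbb{K}$-vector spaces that sends $A$, $|A|=n$, to the vector space $\mathscr{T}_A$ with basis the symbols $z_\alpha$, where $\alpha$ runs over the bijections $[n]\to A$, a bijection $\varphi:A\to B$ acting by $z_\alpha\mapsto z_{\varphi\circ\alpha}$; in particular $\mathbb{K}[\mathfrak{S}_A]$ acts on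 $\mathscr{T}_A$. Concatenation of bijections $[r]\to A$, $[s]\to B$ to a bijection $[r+s]\to A\sqcup B$ extends to bilinear products $\mathscr{T}_A\times\mathscr{T}_B\to\mathscr{T}_{A\sqcup B}$. A (right) ideal is a subfunctor $\mathscr{I}\subset\mathscr{T}$ with $\mathscr{I}_A\cdot\mathscr{T}_B\subset\mathscr{I}_{A\sqcup B}$ for all finite sets $A,B$. The sum of two ideals is formed at each $A$ separately, and $\mathscr{I}(\mathcal{E})$ denotes the smallest ideal containing a set $\mathcal{E}$ of elements of $\mathscr{T}$. \textbf{Tabloids.} For a Young tableau $F:D_\lambda\to[n]$, the Young tabloid $[F]$ is the collection of all elements $t_F(A,T)=\mathfrak{c}_\lambda(T)\cdot z_{T\circ F^{-1}}\in\mathscr{T}_A$, where $A$ is a finite set with $|A|=n$ and $T:D_\lambda\to A$ is a Young tableau. We write $[F]\in\mathscr{I}$ if all these elements lie in the ideal $\mathscr{I}$, and $\mathscr{I}([F_1],[F_2],\dots)$ for the ideal generated by all elements of the tabloids $[F_1],[F_2],\dots$. \textbf{Theorem.} Let $k\le n$ be positive integers, let $\lambda\vdash n$ and $\mu\vdash k$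 be partitions with $\mu\subset\lambda$ (i.e. $\mu_i\le\lambda_i$ for all $i$), and let $F:D_\lambda\to[n]$ be a Young tableau with $F^{-1}([k])=D_\mu$. Let $\mathcal{G}$ be the collection of Young tableaux $G:D_\lambda\to[n]$ such that \begin{enumerate} \item for every $i\in[k]$ the column of $G$ containing $i$ is equal to, or to the left of, the column of $F$ containing $i$, and it is strictly to the left for at least one $i\in[k]$; \item $G^{-1}([k])=D_\delta$ for some partition $\delta\subset\lambda$. \end{enumerate} Let $F_0=F|_{D_\mu}:D_\mu\to[k]$ be the restriction of $F$. Then \[[F]\in\mathscr{I}([F_0])+\mathscr{I}([G]:G\in\mathcal{G}).\] Moreover, writing $G_0:D_\delta\to[k]$ for the restriction of $G\in\mathcal{G}$ to $G^{-1}([k])=D_\delta$, \[[F]\in\mathscr{I}([F_0])+\mathscr{I}([G_0]:G\in\mathcal{G}).\] -/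

import Mathlib

/-!
Young diagrams are Mathlib's `YoungDiagram`: finite lower sets of boxes `(i, j)`, with `i` the row
and `j` the column, both counted from `0`. They are the diagrams `D_λ` of partitions `λ`, and `≤`
is containment. The set `[n]` is `Fin n`, and `[k] ⊆ [n]` is the set of `i : Fin n` with `i < k`.
-/

universe u v

namespace GenericTensor

/-- A Young tableau of shape `lam` and set of entries `A`: a bijection `D_lam → A`. -/
abbrev Tableau (lam : YoungDiagram) (A : Type*) := {c : ℕ × ℕ // c ∈ lam.cells} ≃ A

namespace Tableau

variable {lam : YoungDiagram} {A : Type*}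

/-- The row of the box of `T` with entry `a`. -/
def row (T : Tableau lam A) (a : A) : ℕ := (T.symm a).1.1

/-- The column of the box of `T` with entry `a`. -/
def col (T : Tableau lam A) (a : A) : ℕ := (T.symm a).1.2

/-- The row subgroup of `T`: the permutations of `A` that map every row of `T` to itself. -/
def rowSubgroup (T : Tableau lam A) : Subgroup (Equiv.Perm A) where
  carrier := {σ | ∀ a, T.row (σ a) = T.row a}
  mul_mem' := fun {σ τ} hσ hτ a => (hσ (τ a)).trans (hτ a)
  one_mem' := fun _ => rfl
  inv_mem' := fun {σ} hσ a => by
    have h := hσ (σ⁻¹ a)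
    have e : σ (σ⁻¹ a) = a := σ.apply_symm_apply a
    rw [e] at h
    exact h.symm

/-- The column subgroup of `T`: the permutations of `A` that map every column of `T` to itself. -/
def colSubgroup (T : Tableau lam A) : Subgroup (Equiv.Perm A) where
  carrier := {σ | ∀ a, T.col (σ a) = T.col a}
  mul_mem' := fun {σ τ} hσ hτ a => (hσ (τ a)).trans (hτ a)
  one_mem' := fun _ => rfl
  inv_mem' := fun {σ} hσ a => by
    have h := hσ (σ⁻¹ a)
    have e : σ (σ⁻¹ a) = a := σ.apply_symm_apply a
    rw [e] at h
    exact h.symm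

open Classical in
/-- The row symmetrizer: the sum of the `σ` in the row subgroup of `T`. -/
noncomputable def rowSymmetrizer (K : Type*) [Field K] [Finite A] (T : Tableau lam A) :
    MonoidAlgebra K (Equiv.Perm A) :=
  letI := Fintype.ofFinite A
  ∑ σ : Equiv.Perm A with σ ∈ T.rowSubgroup, MonoidAlgebra.of K (Equiv.Perm A) σ

open Classical in
/-- The column antisymmetrizer: the sum of `sgn(τ) τ` over the `τ` in the column subgroup. -/
noncomputable def colAntisymmetrizer (K : Type*) [Field K] [Finite A] (T : Tableau lam A) :
    MonoidAlgebra K (Equiv.Perm A) :=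
  letI := Fintype.ofFinite A
  ∑ τ : Equiv.Perm A with τ ∈ T.colSubgroup,
    (((Equiv.Perm.sign τ : ℤˣ) : ℤ) : K) • MonoidAlgebra.of K (Equiv.Perm A) τ

/-- The Young symmetrizer of `T`, an element of the group algebra of the symmetric group of `A`. -/
noncomputable def youngSymmetrizer (K : Type*) [Field K] [Finite A] (T : Tableau lam A) :
    MonoidAlgebra K (Equiv.Perm A) :=
  T.rowSymmetrizer K * T.colAntisymmetrizer K

/-- The set of boxes `F⁻¹([k])`. -/
def initialBoxes {n : ℕ} (F : Tableau lam (Fin n)) (k : ℕ) : Set (ℕ × ℕ) :=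
  {c | ∃ h : c ∈ lam.cells, (F ⟨c, h⟩ : ℕ) < k}

/-- If `F⁻¹([k]) = D_mu`, the restriction of `F` to `D_mu`, a tableau `D_mu → [k]`. -/
def restrict {n k : ℕ} {mu : YoungDiagram} (F : Tableau lam (Fin n)) (hk : k ≤ n)
    (h : F.initialBoxes k = (mu.cells : Set (ℕ × ℕ))) : Tableau mu (Fin k) where
  toFun c := ⟨F ⟨c.1, (h.symm.subset c.2).1⟩, (h.symm.subset c.2).2⟩
  invFun i := ⟨(F.symm (Fin.castLE hk i)).1, h.subset
    ⟨(F.symm (Fin.castLE hk i)).2, by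
      rw [Subtype.coe_eta, Equiv.apply_symm_apply]
      exact i.2⟩⟩
  left_inv c := by
    apply Subtype.ext
    have e : Fin.castLE hk ⟨F ⟨c.1, (h.symm.subset c.2).1⟩, (h.symm.subset c.2).2⟩
        = F ⟨c.1, (h.symm.subset c.2).1⟩ := Fin.ext rfl
    simp only [e, Equiv.symm_apply_apply]
  right_inv i := by
    apply Fin.ext
    simp

theorem restrict_apply {n k : ℕ} {mu : YoungDiagram} (F : Tableau lam (Fin n)) (hk : k ≤ n)
    (h : F.initialBoxes k = (mu.cells : Set (ℕ × ℕ))) (c : {c : ℕ × ℕ // c ∈ mu.cells})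
    (hc : c.1 ∈ lam.cells) : (F.restrict hk h c : ℕ) = F ⟨c.1, hc⟩ := rfl

end Tableau

/-- The value at `A` of the generic tensor algebra: the vector space with basis the bijections
`α : [n] → A` (these exist only for `n = |A|`). -/
abbrev TensorSpace (K : Type v) [Field K] (A : Type u) := (Σ n : ℕ, Fin n ≃ A) →₀ K

section TensorSpace

variable (K : Type v) [Field K] {A B C : Type u}

/-- The basis vector `z_α`. -/
noncomputable def z {n : ℕ} (α : Fin n ≃ A) : TensorSpace K A := Finsupp.single ⟨n, α⟩ 1

/-- Functoriality: a bijection `φ : A → B` sends `z_α` to `z_{φ ∘ α}`. -/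
noncomputable def mapT (φ : A ≃ B) : TensorSpace K A →ₗ[K] TensorSpace K B :=
  Finsupp.lmapDomain K K fun p => ⟨p.1, p.2.trans φ⟩

theorem mapT_z (φ : A ≃ B) {n : ℕ} (α : Fin n ≃ A) : mapT K φ (z K α) = z K (α.trans φ) := by
  simp [mapT, z]

theorem mapT_refl : mapT K (Equiv.refl A) = LinearMap.id := by
  exact Finsupp.lmapDomain_id K K

theorem mapT_trans (φ : A ≃ B) (ψ : B ≃ C) :
    mapT K (φ.trans ψ) = mapT K ψ ∘ₗ mapT K φ := by
  ext p : 2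
  simp [mapT, Equiv.trans_assoc]

/-- The action of the symmetric group of `A` on the value at `A`. -/
noncomputable def permRep (A : Type u) : Representation K (Equiv.Perm A) (TensorSpace K A) where
  toFun σ := mapT K σ
  map_one' := mapT_refl K
  map_mul' σ τ := mapT_trans K τ σ

/-- Concatenation of bijections `[r] → A` and `[s] → B` to a bijection `[r + s] → A ⊔ B`. -/
def concat (p : Σ n : ℕ, Fin n ≃ A) (q : Σ n : ℕ, Fin n ≃ B) : Σ n : ℕ, Fin n ≃ (A ⊕ B) :=
  ⟨p.1 + q.1, finSumFinEquiv.symm.trans (Equiv.sumCongr p.2 q.2)⟩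

/-- The multiplication of the generic tensor algebra, the bilinear extension of concatenation. -/
noncomputable def mulT : TensorSpace K A →ₗ[K] TensorSpace K B →ₗ[K] TensorSpace K (A ⊕ B) :=
  Finsupp.linearCombination K fun p => Finsupp.lmapDomain K K (concat p)

theorem mulT_z {r s : ℕ} (α : Fin r ≃ A) (β : Fin s ≃ B) :
    mulT K (z K α) (z K β) = z K (finSumFinEquiv.symm.trans (Equiv.sumCongr α β)) := by
  simp [mulT, z, concat]

end TensorSpace

/-- A (right) ideal of the generic tensor algebra: a subfunctor, stable under multiplication on
the right by all elements. -/
structure GenericIdeal (K : Type v) [Field K] where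
  /-- The subspace at the finite set `A`. -/
  carrier : ∀ (A : Type u) [Finite A], Submodule K (TensorSpace K A)
  map_mem : ∀ {A B : Type u} [Finite A] [Finite B] (φ : A ≃ B) {x : TensorSpace K A},
    x ∈ carrier A → mapT K φ x ∈ carrier B
  mul_mem : ∀ {A B : Type u} [Finite A] [Finite B] {x : TensorSpace K A} (y : TensorSpace K B),
    x ∈ carrier A → mulT K x y ∈ carrier (A ⊕ B)

/-- A set of elements of the generic tensor algebra, sorted by the finite set `A` they live at. -/
abbrev Elements (K : Type v) [Field K] := ∀ (A : Type u) [Finite A], Set (TensorSpace K A)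

namespace GenericIdeal

variable {K : Type v} [Field K]

/-- All the elements of `E` lie in the ideal `I`. -/
def Contains (I : GenericIdeal.{u} K) (E : Elements.{u} K) : Prop :=
  ∀ (A : Type u) [Finite A], E A ⊆ (I.carrier A : Set (TensorSpace K A))

/-- The sum of two ideals. -/
noncomputable instance : Add (GenericIdeal.{u} K) where
  add I J :=
    { carrier := fun A _ => I.carrier A ⊔ J.carrier A
      map_mem := fun φ x hx => by
        obtain ⟨y, hy, w, hw, rfl⟩ := Submodule.mem_sup.1 hx
        rw [map_add]
        exact Submodule.add_mem_sup (I.map_mem φ hy) (J.map_mem φ hw)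
      mul_mem := fun {A B _ _ x} t hx => by
        obtain ⟨y, hy, w, hw, rfl⟩ := Submodule.mem_sup.1 hx
        rw [map_add, LinearMap.add_apply]
        exact Submodule.add_mem_sup (I.mul_mem t hy) (J.mul_mem t hw) }

/-- The ideal generated by a set of elements: the intersection of the ideals that contain it. -/
noncomputable def generatedBy (E : Elements.{u} K) : GenericIdeal.{u} K where
  carrier A _ := ⨅ I : {I : GenericIdeal.{u} K // I.Contains E}, I.1.carrier A
  map_mem φ x hx := by
    rw [Submodule.mem_iInf] at hx ⊢
    exact fun I => I.1.map_mem φ (hx I)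
  mul_mem y hx := by
    rw [Submodule.mem_iInf] at hx ⊢
    exact fun I => I.1.mul_mem y (hx I)

theorem generatedBy_contains (E : Elements.{u} K) : (generatedBy E).Contains E := by
  intro A _ x hx
  simp only [generatedBy, SetLike.mem_coe, Submodule.mem_iInf]
  exact fun I => I.2 A hx

theorem generatedBy_le (E : Elements.{u} K) (I : GenericIdeal.{u} K) (h : I.Contains E)
    (A : Type u) [Finite A] : (generatedBy E).carrier A ≤ I.carrier A :=
  iInf_le (fun J : {J : GenericIdeal.{u} K // J.Contains E} => J.1.carrier A) ⟨I, h⟩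

end GenericIdeal

section Tabloid

variable (K : Type v) [Field K] {lam : YoungDiagram} {n : ℕ}

/-- The element `t_F(A, T)`: the Young symmetrizer of `T` applied to `z_{T ∘ F⁻¹}`. -/
noncomputable def tabloidElement (F : Tableau lam (Fin n)) {A : Type u} [Finite A]
    (T : Tableau lam A) : TensorSpace K A :=
  (permRep K A).asAlgebraHom (T.youngSymmetrizer K) (z K (F.symm.trans T))

/-- The Young tabloid `[F]`: the collection of all `t_F(A, T)`, for `A` a finite set with
`|A| = n` and `T : D_lam → A` a Young tableau. -/
def tabloid (F : Tableau lam (Fin n)) : Elements.{u} K :=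
  fun A _ => {x | ∃ T : Tableau lam A, x = tabloidElement K F T}

end Tabloid

/-- The tableaux `G : D_lam → [n]` in which every entry of `[k]` is in the same column as in `F`
or further left, at least one of them strictly further left, and for which `G⁻¹([k])` is the
diagram of a partition contained in `lam`. -/
def leftMoves {lam : YoungDiagram} {n : ℕ} (F : Tableau lam (Fin n)) (k : ℕ) :
    Set (Tableau lam (Fin n)) :=
  {G | (∀ i : Fin n, (i : ℕ) < k → G.col i ≤ F.col i) ∧
    (∃ i : Fin n, (i : ℕ) < k ∧ G.col i < F.col i) ∧
    ∃ delta : YoungDiagram, delta ≤ lam ∧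
      G.initialBoxes k = (delta.cells : Set (ℕ × ℕ))}

/-- The union of the tabloids `[G]`, for `G` in a set of tableaux. -/
def tabloids (K : Type v) [Field K] {lam : YoungDiagram} {n : ℕ}
    (S : Set (Tableau lam (Fin n))) : Elements.{u} K :=
  fun A _ => {x | ∃ G ∈ S, x ∈ tabloid K G A}

/-- The union of the tabloids `[G₀]`, for `G` in a set of tableaux, where `G₀` is the restriction
of `G` to the diagram `G⁻¹([k])`. -/
def restrictedTabloids (K : Type v) [Field K] {lam : YoungDiagram} {n k : ℕ} (hk : k ≤ n)
    (S : Set (Tableau lam (Fin n))) : Elements.{u} K :=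
  fun A _ => {x | ∃ G ∈ S, ∃ (delta : YoungDiagram)
    (h : G.initialBoxes k = (delta.cells : Set (ℕ × ℕ))), x ∈ tabloid K (G.restrict hk h) A}

end GenericTensor

/-! Write n = k + m and let permutations of positions act on formal sums of bijections by
precomposition. This commutes with the Young symmetrizer of `T`, so t_F(A, T) is a polytabloid e
that is antisymmetric along columns and obeys Garnir relations. In particular, summing the exchanges
of one position with all positions of a column further left returns e
(`sum_rightRep_swap_polytabloid`).

Measure polytabloids by the sum of the columns of the first k positions, and let W be the span of
those with a smaller sum than e. Exchanging one of these positions with a later position further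
left lands in W, so modulo W the vector e satisfies the column and exchange relations of F₀ alone.
Let a and b be the row symmetrizer and the column antisymmetrizer of F₀, acting on positions. A
vector v with these relations is a multiple of b a v (`exists_eq_smul_symSum_symSum`): eigenvalues
of the central sum of transpositions show that a v = 0 forces v = 0, and von Neumann's lemma
finishes.

Hence e - c b a e lies in W. Applying b, which multiplies e and b a e by positive integers, puts e -
c' b a e in b W. The term b a e lies in the ideal of [F₀] (`toTensor_symSum_mem`). Elements of b W
are rewritten by polytabloids in which no initial position is to the right of its column in F
(`symSum_polytabloid_mem_span`), and then straightened until these positions fill a diagram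
(`polytabloid_mem_lowerSpan`). The smaller column sum makes one move strict. The second claim
follows by induction on the column sum. -/

namespace GenericTensor

/-! ### Symmetrizers and antisymmetrizers over block-preserving permutations. -/

section Symmetrizers

open Equiv

variable {K N A : Type*} [Field K] [AddCommGroup N] [Module K N]

/-- The permutations of `A` that preserve the values of `r`. -/
def fiberStabilizer {β : Type*} (r : A → β) : Subgroup (Perm A) where
  carrier := {σ | ∀ a, r (σ a) = r a}
  mul_mem' := fun {σ τ} hσ hτ a => (hσ (τ a)).trans (hτ a)
  one_mem' := fun _ => rfl
  inv_mem' := fun {σ} hσ a => by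
    have h := hσ (σ⁻¹ a)
    have e : σ (σ⁻¹ a) = a := σ.apply_symm_apply a
    rw [e] at h
    exact h.symm

theorem mem_fiberStabilizer {β : Type*} {r : A → β} {σ : Perm A} :
    σ ∈ fiberStabilizer r ↔ ∀ a, r (σ a) = r a := Iff.rfl

theorem rep_mul_apply (ρ : Representation K (Perm A) N) (g h : Perm A) (x : N) :
    ρ (g * h) x = ρ g (ρ h x) := by rw [map_mul, Module.End.mul_apply]

variable (K) in
theorem eq_zero_of_neg_eq_self [CharZero K] {x : N} (h : -x = x) : x = 0 := by
  have h2 : (2 : K) • x = 0 := by rw [two_smul, ← neg_eq_iff_add_eq_zero, h]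
  exact (smul_eq_zero.1 h2).resolve_left two_ne_zero

theorem swap_mem_fiberStabilizer [DecidableEq A] {β : Type*} {r : A → β} {x y : A}
    (h : r x = r y) : swap x y ∈ fiberStabilizer r := by
  intro a
  by_cases hx : a = x
  · subst hx; simp [h]
  · by_cases hy : a = y
    · subst hy; simp [h]
    · rw [swap_apply_of_ne_of_ne hx hy]

/-- The twist of a representation of a symmetric group by the sign character. -/
noncomputable def signTwist [Fintype A] [DecidableEq A] (ρ : Representation K (Perm A) N) :
    Representation K (Perm A) N where
  toFun σ := (((Perm.sign σ : ℤˣ) : ℤ) : K) • ρ σ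
  map_one' := by simp
  map_mul' σ τ := by
    ext x
    simp only [map_mul, Units.val_mul, Int.cast_mul, LinearMap.smul_apply, Module.End.mul_apply,
      map_smul, mul_smul]
    exact smul_comm _ _ _

theorem signTwist_apply [Fintype A] [DecidableEq A] (ρ : Representation K (Perm A) N)
    (σ : Perm A) (x : N) : signTwist ρ σ x = (((Perm.sign σ : ℤˣ) : ℤ) : K) • ρ σ x := rfl

theorem signTwist_swap [Fintype A] [DecidableEq A] (ρ : Representation K (Perm A) N)
    {x y : A} (h : x ≠ y) (w : N) : signTwist ρ (swap x y) w = - ρ (swap x y) w := by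
  simp [signTwist_apply, Perm.sign_swap h]

theorem sign_smul_sign_smul [Fintype A] [DecidableEq A] (σ : Perm A) (w : N) :
    (((Perm.sign σ : ℤˣ) : ℤ) : K) • (((Perm.sign σ : ℤˣ) : ℤ) : K) • w = w := by
  rw [smul_smul, ← Int.cast_mul, ← Units.val_mul, Int.units_mul_self]
  simp

theorem signTwist_eq_self_iff [Fintype A] [DecidableEq A] (ρ : Representation K (Perm A) N)
    (σ : Perm A) (w : N) :
    signTwist ρ σ w = w ↔ ρ σ w = (((Perm.sign σ : ℤˣ) : ℤ) : K) • w := by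
  rw [signTwist_apply]
  constructor
  · intro h
    rw [← sign_smul_sign_smul (K := K) σ (ρ σ w), h]
  · intro h
    rw [h, sign_smul_sign_smul]

open Classical in
/-- The sum of the operators of the permutations that preserve the values of `r`. -/
noncomputable def symSum [Fintype A] {β : Type*} (ρ : Representation K (Perm A) N)
    (r : A → β) : N →ₗ[K] N :=
  ∑ σ : Perm A with σ ∈ fiberStabilizer r, ρ σ

section

variable [Fintype A] {β : Type*} (ρ : Representation K (Perm A) N) (r : A → β)

open Classical in
theorem symSum_apply (x : N) :
    symSum ρ r x = ∑ σ : Perm A with σ ∈ fiberStabilizer r, ρ σ x := by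
  simp [symSum, LinearMap.sum_apply]

variable {ρ r}

theorem symSum_comp_right {κ : Perm A} (hκ : κ ∈ fiberStabilizer r) (x : N) :
    symSum ρ r (ρ κ x) = symSum ρ r x := by
  classical
  rw [symSum_apply, symSum_apply]
  refine Finset.sum_equiv (Equiv.mulRight κ) (fun σ => ?_) (fun σ _ => ?_)
  · simp [Subgroup.mul_mem_cancel_right _ hκ]
  · simp

theorem symSum_comp_left {κ : Perm A} (hκ : κ ∈ fiberStabilizer r) (x : N) :
    ρ κ (symSum ρ r x) = symSum ρ r x := by
  classical
  rw [symSum_apply, map_sum]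
  refine Finset.sum_equiv (Equiv.mulLeft κ) (fun σ => ?_) (fun σ _ => ?_)
  · simp [Subgroup.mul_mem_cancel_left _ hκ]
  · simp

theorem symSum_of_invariant {w : N} (hw : ∀ σ ∈ fiberStabilizer r, ρ σ w = w) :
    ∃ c : ℕ, 0 < c ∧ symSum ρ r w = (c : K) • w := by
  classical
  refine ⟨(Finset.univ.filter fun σ : Perm A => σ ∈ fiberStabilizer r).card,
    Finset.card_pos.2 ⟨1, by simp [one_mem]⟩, ?_⟩
  rw [symSum_apply, Finset.sum_congr rfl (g := fun _ => w), Finset.sum_const, Nat.cast_smul_eq_nsmul]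
  intro σ hσ
  exact hw σ (Finset.mem_filter.1 hσ).2

theorem symSum_signTwist_swap [DecidableEq A] {x y : A} (hxy : x ≠ y) (h : r x = r y) (w : N) :
    symSum (signTwist ρ) r (ρ (swap x y) w) = - symSum (signTwist ρ) r w := by
  rw [← symSum_comp_right (ρ := signTwist ρ) (swap_mem_fiberStabilizer h) w,
    signTwist_swap ρ hxy, map_neg, neg_neg]

theorem symSum_map {N' : Type*} [AddCommGroup N'] [Module K N']
    {ρ' : Representation K (Perm A) N'} (f : N →ₗ[K] N') (hf : ∀ σ x, f (ρ σ x) = ρ' σ (f x))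
    (x : N) : f (symSum ρ r x) = symSum ρ' r (f x) := by
  classical
  simp [symSum_apply, hf]

end

theorem signTwist_map [Fintype A] [DecidableEq A] {ρ : Representation K (Perm A) N}
    {N' : Type*} [AddCommGroup N'] [Module K N']
    {ρ' : Representation K (Perm A) N'} (f : N →ₗ[K] N') (hf : ∀ σ x, f (ρ σ x) = ρ' σ (f x))
    (σ : Perm A) (x : N) : f (signTwist ρ σ x) = signTwist ρ' σ (f x) := by
  simp [signTwist_apply, hf]

/-- If `w` is fixed by the permutations preserving `r`, and `y` is moved to the block `i`, then
the sum of the images of `w` under the exchanges of `y` with the elements of the new block is fixed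
by the permutations preserving the new blocks. -/
theorem exchange_sum_invariant [Fintype A] [DecidableEq A] {β : Type*} [DecidableEq β]
    (ρ : Representation K (Perm A) N) (r : A → β) (y : A) (i : β) {w : N}
    (hw : ∀ σ ∈ fiberStabilizer r, ρ σ w = w) :
    ∀ σ ∈ fiberStabilizer (Function.update r y i),
      ρ σ (∑ x with Function.update r y i x = i, ρ (swap x y) w) =
        ∑ x with Function.update r y i x = i, ρ (swap x y) w := by
  intro σ hσ
  set r' := Function.update r y i with hr'
  rw [map_sum]
  refine Finset.sum_equiv σ (fun x => ?_) (fun x hx => ?_)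
  · simp [mem_fiberStabilizer.1 hσ x]
  · have hx' : r' x = i := (Finset.mem_filter.1 hx).2
    have hy : r' y = i := by simp [hr']
    -- `κ` corrects `σ` so that `y` is fixed. Preserving the new blocks and fixing `y`, it preserves
    -- the old blocks, so `w` absorbs it.
    set κ := swap (σ x) y * σ * swap x y with hκ
    have hκmem : κ ∈ fiberStabilizer r' :=
      mul_mem (mul_mem (swap_mem_fiberStabilizer (by rw [hσ x, hx', hy])) hσ)
        (swap_mem_fiberStabilizer (by rw [hx', hy]))
    have hκy : κ y = y := by simp [hκ]
    have hκr : κ ∈ fiberStabilizer r := by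
      intro a
      by_cases ha : a = y
      · rw [ha, hκy]
      · have hka : κ a ≠ y := fun h => ha (κ.injective (h.trans hκy.symm))
        have := hκmem a
        rwa [hr', Function.update_of_ne ha, Function.update_of_ne hka] at this
    have : σ * swap x y = swap (σ x) y * κ := by
      rw [hκ, ← mul_assoc, ← mul_assoc, swap_mul_self, one_mul]
    rw [← Module.End.mul_apply, ← map_mul, this, map_mul, Module.End.mul_apply, hw κ hκr]

theorem exchange_sum_eq [Fintype A] [DecidableEq A] {β : Type*} [DecidableEq β]
    (ρ : Representation K (Perm A) N) (r : A → β) (y : A) (i : β) (hy : r y ≠ i) (w : N) :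
    ∑ x with Function.update r y i x = i, ρ (swap x y) w =
      w + ∑ x with r x = i, ρ (swap x y) w := by
  have : (Finset.univ.filter fun x => Function.update r y i x = i) =
      insert y (Finset.univ.filter fun x => r x = i) := by
    ext x
    by_cases h : x = y
    · subst h; simp
    · simp [h]
  rw [this, Finset.sum_insert (by simp [hy]), swap_self, ← Perm.one_def, map_one,
    Module.End.one_apply]

end Symmetrizers

namespace Tableau

variable {A : Type*} {mu : YoungDiagram} (T : Tableau mu A)

theorem eq_of_row_col {x y : A} (hr : T.row x = T.row y) (hc : T.col x = T.col y) : x = y :=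
  T.symm.injective (Subtype.ext (Prod.ext hr hc))

theorem row_apply (c : {c : ℕ × ℕ // c ∈ mu.cells}) : T.row (T c) = c.1.1 := by simp [row]

theorem col_apply (c : {c : ℕ × ℕ // c ∈ mu.cells}) : T.col (T c) = c.1.2 := by simp [col]

theorem row_col_mem (x : A) : (T.row x, T.col x) ∈ mu := (T.symm x).2

theorem card_filter_col [Fintype A] (j : ℕ) :
    (Finset.univ.filter fun x => T.col x = j).card = mu.colLen j := by
  rw [mu.colLen_eq_card]
  refine Finset.card_bij (fun x _ => (T.symm x).1) (fun x hx => ?_) (fun x _ y _ h => ?_)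
    (fun c hc => ?_)
  · exact YoungDiagram.mem_col_iff.2 ⟨(T.symm x).2, (Finset.mem_filter.1 hx).2⟩
  · exact T.symm.injective (Subtype.ext h)
  · obtain ⟨h1, h2⟩ := YoungDiagram.mem_col_iff.1 hc
    exact ⟨T ⟨c, h1⟩, by simp [col_apply, h2], by simp⟩

end Tableau

/-! ### Counting pairs: labellings transverse to the columns of a tableau. -/

section Combinatorics

open Equiv

variable {A : Type*} [Fintype A]

theorem card_filter_lt_le (f g : A → ℕ) (h : ∀ x y, f x = f y → g x = g y → x = y) (y : A) :
    (Finset.univ.filter fun x => f x = f y ∧ g x < g y).card ≤ g y := by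
  conv_rhs => rw [← Finset.card_range (g y)]
  refine Finset.card_le_card_of_injOn g (fun x hx => ?_) (fun x hx z hz hxz => ?_)
  · simp only [Finset.coe_filter, Finset.mem_univ, true_and, Set.mem_ofPred_eq] at hx
    simp [hx.2]
  · simp only [Finset.coe_filter, Finset.mem_univ, true_and, Set.mem_ofPred_eq] at hx hz
    exact h x z (hx.1.trans hz.1.symm) hxz

variable [DecidableEq A]

/-- The number of ordered pairs of distinct elements with the same value of `f`. -/
def pairCount (f : A → ℕ) : ℕ := ∑ y, (Finset.univ.filter fun x => x ≠ y ∧ f x = f y).card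

/-- Since `g` separates the points of each fiber of `f`, it orders every pair in one way; the factor
2 counts both orders. With `card_filter_lt_le` this bounds pair counts by sums of `g`. -/
theorem pairCount_eq (f g : A → ℕ) (h : ∀ x y, f x = f y → g x = g y → x = y) :
    pairCount f = 2 * ∑ y, (Finset.univ.filter fun x => f x = f y ∧ g x < g y).card := by
  have h1 : ∀ y, (Finset.univ.filter fun x => x ≠ y ∧ f x = f y).card =
      (∑ x, if f x = f y ∧ g x < g y then 1 else 0) +
        ∑ x, if f y = f x ∧ g y < g x then 1 else 0 := by
    intro y
    rw [Finset.card_filter, ← Finset.sum_add_distrib]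
    refine Finset.sum_congr rfl fun x _ => ?_
    have := h x y
    rcases lt_trichotomy (g x) (g y) with hg | hg | hg <;> split_ifs <;> grind
  simp only [pairCount, h1, Finset.sum_add_distrib, Finset.card_filter]
  rw [Finset.sum_comm (f := fun y x => if f y = f x ∧ g y < g x then 1 else 0), two_mul]

namespace Tableau

variable {mu : YoungDiagram} (T : Tableau mu A)

/-- A labelling of the entries that is injective on every column, and whose sum is at most
the sum of the row indices, is a column permutation of the labelling by rows. -/
theorem exists_colSubgroup_of_sum_le (r : A → ℕ)
    (hinj : ∀ x y, r x = r y → T.col x = T.col y → x = y)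
    (hsum : 2 * ∑ y, r y ≤ pairCount T.col) :
    ∃ τ ∈ T.colSubgroup, ∀ y, r y = T.row (τ y) := by
  have hinj' : ∀ x y, T.col x = T.col y → r x = r y → x = y := fun x y h1 h2 => hinj x y h2 h1
  rw [pairCount_eq T.col r hinj'] at hsum
  have hle := fun y => card_filter_lt_le T.col r hinj' y
  -- Each count is at most `r y`, and the totals agree by `hsum`, so equality holds termwise: on a
  -- column of length ℓ the labels are exactly 0, …, ℓ - 1.
  have heq : ∀ y, (Finset.univ.filter fun x => T.col x = T.col y ∧ r x < r y).card = r y := by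
    have := (Finset.sum_eq_sum_iff_of_le (s := Finset.univ) (fun y _ => hle y)).1
      (le_antisymm (Finset.sum_le_sum fun y _ => hle y) (by omega))
    exact fun y => this y (Finset.mem_univ y)
  have hmem : ∀ y, (r y, T.col y) ∈ mu.cells := by
    intro y
    rw [YoungDiagram.mem_cells, YoungDiagram.mem_iff_lt_colLen, ← T.card_filter_col]
    nth_rewrite 1 [← heq y]
    refine Finset.card_lt_card ⟨fun x hx => ?_, fun h => ?_⟩
    · simp only [Finset.mem_filter, Finset.mem_univ, true_and] at hx ⊢
      exact hx.1
    · have := h (show y ∈ _ by simp)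
      simp at this
  let f : A → A := fun y => T ⟨(r y, T.col y), hmem y⟩
  have hf : Function.Injective f := by
    intro x y h
    have := congrArg Subtype.val (T.injective h)
    exact hinj x y (Prod.ext_iff.1 this).1 (Prod.ext_iff.1 this).2
  refine ⟨Equiv.ofBijective f (Finite.injective_iff_bijective.1 hf), fun y => ?_, fun y => ?_⟩
  · exact T.col_apply _
  · exact (T.row_apply ⟨(r y, T.col y), hmem y⟩).symm

/-- The entries above `y` in its column account for `T.row y` pairs. This is the sum hypothesis of
`exists_colSubgroup_of_sum_le` for the row labelling. -/
theorem two_mul_sum_row_le : 2 * ∑ y, T.row y ≤ pairCount T.col := by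
  rw [pairCount_eq T.col T.row fun x y h1 h2 => T.eq_of_row_col h2 h1]
  refine Nat.mul_le_mul_left 2 (Finset.sum_le_sum fun y _ => ?_)
  have hm : ∀ i < T.row y, (i, T.col y) ∈ mu.cells := fun i hi =>
    mu.up_left_mem hi.le le_rfl (T.row_col_mem y)
  rw [← Fintype.card_fin (T.row y), ← Finset.card_univ]
  refine Finset.card_le_card_of_injOn (fun i => T ⟨(i, T.col y), hm i i.2⟩) (fun i _ => ?_)
    (fun i _ k _ h => ?_)
  · simp [row_apply, col_apply]
  · have := congrArg (fun c => c.1.1) (T.injective h)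
    exact Fin.ext this

end Tableau

end Combinatorics

/-! ### The central sum of transpositions and its eigenvalues. -/

section ClassSum

open Equiv

variable {K N A : Type*} [Field K] [AddCommGroup N] [Module K N] [Fintype A] [DecidableEq A]
  (ρ : Representation K (Perm A) N)

/-- The sum over all ordered pairs of the operators of their transpositions. -/
noncomputable def swapSum : N →ₗ[K] N := ∑ y, ∑ x, ρ (swap x y)

theorem swapSum_comm (g : Perm A) (w : N) : swapSum ρ (ρ g w) = ρ g (swapSum ρ w) := by
  simp only [swapSum, LinearMap.sum_apply, map_sum]
  rw [← Equiv.sum_comp g]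
  refine Finset.sum_congr rfl fun y _ => ?_
  rw [← Equiv.sum_comp g]
  refine Finset.sum_congr rfl fun x _ => ?_
  rw [← Module.End.mul_apply, ← Module.End.mul_apply, ← map_mul, ← map_mul, mul_swap_eq_swap_mul]

/-- The diagonal pairs give `Fintype.card A`, pairs inside a block give `ε` each, and each `y`
contributes `-ε` for every block below its own. Pairs in the opposite order contribute the same
again. The case `ε = -1` serves for columns, `ε = 1` for rows. -/
theorem swapSum_apply_eq (r : A → ℕ) (ε : K) (w : N)
    (h1 : ∀ x y, x ≠ y → r x = r y → ρ (swap x y) w = ε • w)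
    (h2 : ∀ y, ∀ i < r y, ∑ x with r x = i, ρ (swap x y) w = -(ε • w)) :
    swapSum ρ w =
      ((Fintype.card A : K) + ε * ((pairCount r : K) - 2 * ((∑ y, r y : ℕ) : K))) • w := by
  have hlt : ∀ y, ∑ x with r x < r y, ρ (swap x y) w = (r y : K) • -(ε • w) := by
    intro y
    rw [← Finset.sum_fiberwise_of_maps_to (t := Finset.range (r y)) (g := r)
      (fun x hx => by simpa using hx)]
    rw [Finset.sum_congr rfl (g := fun _ => -(ε • w))]
    · rw [Finset.sum_const, Finset.card_range, Nat.cast_smul_eq_nsmul]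
    · intro i hi
      rw [← h2 y i (Finset.mem_range.1 hi)]
      refine Finset.sum_congr ?_ fun _ _ => rfl
      ext x
      simp only [Finset.mem_filter, Finset.mem_univ, true_and, Finset.mem_range] at hi ⊢
      omega
  have hsplit : ∀ y, ∑ x, ρ (swap x y) w = w +
      ∑ x with x ≠ y ∧ r x = r y, ρ (swap x y) w + ∑ x with r x < r y, ρ (swap x y) w +
      ∑ x with r y < r x, ρ (swap x y) w := by
    intro y
    have : w = ∑ x with x = y, ρ (swap x y) w := by
      rw [Finset.filter_eq' Finset.univ y, if_pos (Finset.mem_univ y), Finset.sum_singleton,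
        swap_self, ← Perm.one_def, map_one, Module.End.one_apply]
    nth_rewrite 2 [this]
    simp only [Finset.sum_filter, ← Finset.sum_add_distrib]
    refine Finset.sum_congr rfl fun x _ => ?_
    by_cases hxy : x = y
    · subst hxy; simp
    · rcases lt_trichotomy (r x) (r y) with h | h | h
      · simp [hxy, h, h.ne, h.not_gt]
      · simp [hxy, h]
      · simp [hxy, h, h.ne', h.not_gt]
  have hgt : ∑ y, ∑ x with r y < r x, ρ (swap x y) w = ∑ y, (r y : K) • -(ε • w) := by
    simp only [← hlt, Finset.sum_filter]
    rw [Finset.sum_comm]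
    simp only [swap_comm]
  have heq : ∀ y, ∑ x with x ≠ y ∧ r x = r y, ρ (swap x y) w =
      ((Finset.univ.filter fun x => x ≠ y ∧ r x = r y).card : K) • (ε • w) := by
    intro y
    rw [Nat.cast_smul_eq_nsmul, ← Finset.sum_const]
    refine Finset.sum_congr rfl fun x hx => ?_
    simp only [Finset.mem_filter, Finset.mem_univ, true_and] at hx
    exact h1 x y hx.1 hx.2
  rw [swapSum]
  simp only [LinearMap.sum_apply, hsplit, Finset.sum_add_distrib, hgt, heq, hlt]
  simp only [← Finset.sum_smul, Finset.sum_const, Finset.card_univ, ← Nat.cast_sum]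
  rw [pairCount, ← Nat.cast_smul_eq_nsmul K]
  module

end ClassSum

/-! ### Vectors with the column and exchange relations of a tableau. -/

section Cyclic

open Equiv

variable {K N A : Type*} [Field K] [AddCommGroup N] [Module K N]
  {ρ : Representation K (Perm A) N} {mu : YoungDiagram} {T : Tableau mu A} {v : N}

/-- The subspace spanned by the orbit of a vector. -/
def orbitSpan (ρ : Representation K (Perm A) N) (v : N) : Submodule K N :=
  Submodule.span K (Set.range fun g => ρ g v)

theorem mem_orbitSpan (g : Perm A) : ρ g v ∈ orbitSpan ρ v := Submodule.subset_span ⟨g, rfl⟩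

theorem self_mem_orbitSpan : v ∈ orbitSpan ρ v := by
  simpa using mem_orbitSpan (ρ := ρ) (v := v) 1

theorem orbitSpan_induction {p : N → Prop} (h0 : p 0) (hadd : ∀ x y, p x → p y → p (x + y))
    (hsmul : ∀ (c : K) x, p x → p (c • x)) (hg : ∀ g, p (ρ g v)) {w : N}
    (hw : w ∈ orbitSpan ρ v) : p w := by
  induction hw using Submodule.span_induction with
  | mem x hx => obtain ⟨g, rfl⟩ := hx; exact hg g
  | zero => exact h0
  | add x y _ _ hx hy => exact hadd x y hx hy
  | smul c x _ hx => exact hsmul c x hx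

theorem orbitSpan_stable (g : Perm A) {w : N} (hw : w ∈ orbitSpan ρ v) :
    ρ g w ∈ orbitSpan ρ v := by
  refine orbitSpan_induction (p := fun w => ρ g w ∈ orbitSpan ρ v) (by simp)
    (fun x y hx hy => ?_) (fun c x hx => ?_) (fun h => ?_) hw
  · rw [map_add]; exact add_mem hx hy
  · rw [map_smul]; exact Submodule.smul_mem _ _ hx
  · rw [← Module.End.mul_apply, ← map_mul]; exact mem_orbitSpan _

variable [Fintype A] [DecidableEq A]

theorem swapSum_apply_of_exchange
    (hC : ∀ τ ∈ fiberStabilizer T.col, signTwist ρ τ v = v)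
    (hR : ∀ y, ∀ j < T.col y, ∑ x with T.col x = j, ρ (swap x y) v = v) :
    swapSum ρ v = ((Fintype.card A : K) +
      (-1) * ((pairCount T.col : K) - 2 * ((∑ y, T.col y : ℕ) : K))) • v := by
  refine swapSum_apply_eq ρ T.col (-1) v (fun x y hxy h => ?_) (fun y j hj => ?_)
  · have := hC _ (swap_mem_fiberStabilizer h)
    rw [signTwist_swap ρ hxy] at this
    rw [neg_one_smul, ← this, neg_neg, this]
  · rw [hR y j hj, neg_one_smul, neg_neg]

/-- Take `r` of least sum among the labellings whose stabilizer fixes a nonzero vector of the orbit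
span; injective labellings show that some exist. Moving `y` to a lower block would give an invariant
vector of smaller sum, so the exchange sum vanishes, as `swapSum_apply_eq` requires. This plays the
role of a highest weight vector. -/
theorem exists_minimal_invariant (hv : v ≠ 0) :
    ∃ r : A → ℕ, ∃ w ∈ orbitSpan ρ v, w ≠ 0 ∧ (∀ σ ∈ fiberStabilizer r, ρ σ w = w) ∧
      swapSum ρ w =
        ((Fintype.card A : K) + 1 * ((pairCount r : K) - 2 * ((∑ y, r y : ℕ) : K))) • w := by
  classical
  let P : ℕ → Prop := fun m => ∃ r : A → ℕ, ∑ y, r y = m ∧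
    ∃ w ∈ orbitSpan ρ v, w ≠ 0 ∧ ∀ σ ∈ fiberStabilizer r, ρ σ w = w
  have hP : ∃ m, P m := by
    refine ⟨_, fun x => (Fintype.equivFin A x : ℕ), rfl, v, self_mem_orbitSpan, hv, ?_⟩
    intro σ hσ
    have : σ = 1 := Equiv.ext fun a => (Fintype.equivFin A).injective (Fin.ext (hσ a))
    rw [this, map_one, Module.End.one_apply]
  obtain ⟨r, hr, w, hwX, hw0, hw⟩ := Nat.find_spec hP
  refine ⟨r, w, hwX, hw0, hw, ?_⟩
  refine swapSum_apply_eq ρ r 1 w (fun x y _ h => ?_) (fun y i hi => ?_)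
  · rw [one_smul]; exact hw _ (swap_mem_fiberStabilizer h)
  · by_contra hne
    refine Nat.find_min hP (m := ∑ x, Function.update r y i x) ?_
      ⟨_, rfl, _, ?_, ?_, exchange_sum_invariant ρ r y i hw⟩
    · rw [← hr]
      refine Finset.sum_lt_sum (fun x _ => ?_) ⟨y, Finset.mem_univ y, by simpa using hi⟩
      by_cases hx : x = y
      · subst hx; simpa using hi.le
      · simp [hx]
    · exact Submodule.sum_mem _ fun x _ => orbitSpan_stable _ hwX
    · rw [exchange_sum_eq ρ r y i hi.ne']
      intro h0
      apply hne
      rw [one_smul, eq_neg_iff_add_eq_zero, add_comm, h0]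

/-- If `v` were nonzero, `swapSum` would act on the orbit span by a scalar computed both from the
columns of `T` and from a minimal invariant `w`. The resulting identity of pair counts forces the
blocks of `r`, moved by some `g`, to be the rows of `T` up to a column permutation. The symmetrizer
of `r` is then conjugate to that of the rows, which kills `v`. -/
theorem eq_zero_of_symSum_eq_zero [CharZero K]
    (hC : ∀ τ ∈ fiberStabilizer T.col, signTwist ρ τ v = v)
    (hR : ∀ y, ∀ j < T.col y, ∑ x with T.col x = j, ρ (swap x y) v = v)
    (ha : symSum ρ T.row v = 0) : v = 0 := by
  by_contra hv
  obtain ⟨r, w, hwX, hw0, hw, hwZ⟩ := exists_minimal_invariant (ρ := ρ) hv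
  have hvZ := swapSum_apply_of_exchange hC hR
  have hwZ' : swapSum ρ w = ((Fintype.card A : K) +
      (-1) * ((pairCount T.col : K) - 2 * ((∑ y, T.col y : ℕ) : K))) • w := by
    refine orbitSpan_induction (p := fun w => swapSum ρ w = _ • w) (by simp)
      (fun x y hx hy => ?_) (fun c x hx => ?_) (fun g => ?_) hwX
    · rw [map_add, hx, hy, smul_add]
    · rw [map_smul, hx, smul_comm]
    · rw [swapSum_comm, hvZ, map_smul]
  have hct : pairCount r + pairCount T.col = 2 * ∑ y, T.col y + 2 * ∑ y, r y := by
    have := smul_left_injective K hw0 (hwZ.symm.trans hwZ')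
    have h2 : ((pairCount r + pairCount T.col : ℕ) : K) =
        ((2 * ∑ y, T.col y + 2 * ∑ y, r y : ℕ) : K) := by
      push_cast at this ⊢
      linear_combination this
    exact_mod_cast h2
  -- The symmetrizer multiplies `w` by a positive integer, and `w` is a combination of the `ρ g v`.
  obtain ⟨g, hg⟩ : ∃ g, symSum ρ r (ρ g v) ≠ 0 := by
    by_contra! hall
    have h0 : symSum ρ r w = 0 := by
      refine orbitSpan_induction (p := fun w => symSum ρ r w = 0) (by simp)
        (fun x y hx hy => by rw [map_add, hx, hy, add_zero])
        (fun c x hx => by rw [map_smul, hx, smul_zero]) hall hwX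
    obtain ⟨c, hc, h⟩ := symSum_of_invariant hw
    rw [h0] at h
    rcases smul_eq_zero.1 h.symm with h | h
    · exact hc.ne' (by exact_mod_cast h)
    · exact hw0 h
  -- Otherwise one transposition would be absorbed by the symmetrizer and act on `v` by -1.
  have hinj : ∀ x y, r (g x) = r (g y) → T.col x = T.col y → x = y := by
    intro x y h1 h2
    by_contra hxy
    have h3 := symSum_comp_right (ρ := ρ) (swap_mem_fiberStabilizer h1) (ρ g v)
    have h4 := hC _ (swap_mem_fiberStabilizer h2)
    rw [signTwist_swap ρ hxy, neg_eq_iff_eq_neg] at h4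
    rw [← rep_mul_apply, ← mul_swap_eq_swap_mul, rep_mul_apply, h4, map_neg, map_neg] at h3
    exact hg (eq_zero_of_neg_eq_self K h3)
  have hsum : ∑ y, r (g y) = ∑ y, r y := Equiv.sum_comp g r
  have hle : pairCount r ≤ 2 * ∑ y, T.col y := by
    have e : ∑ y, T.col (g⁻¹ y) = ∑ y, T.col y := Equiv.sum_comp g⁻¹ T.col
    rw [pairCount_eq r (fun x => T.col (g⁻¹ x)), ← e]
    · refine Nat.mul_le_mul_left 2 (Finset.sum_le_sum fun y _ => ?_)
      refine card_filter_lt_le r (fun x => T.col (g⁻¹ x)) (fun x y h1 h2 => ?_) y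
      exact g⁻¹.injective (hinj _ _ (by simpa using h1) h2)
    · intro x y h1 h2
      exact g⁻¹.injective (hinj _ _ (by simpa using h1) h2)
  obtain ⟨τ, hτ, hrow⟩ := T.exists_colSubgroup_of_sum_le (fun x => r (g x)) hinj (by omega)
  apply hg
  have key : symSum ρ r (ρ g v) = ρ (g * τ⁻¹) (symSum ρ T.row (ρ τ v)) := by
    classical
    rw [symSum_apply, symSum_apply, map_sum]
    refine Finset.sum_equiv (MulAut.conj (τ * g⁻¹)).toEquiv (fun σ => ?_) (fun σ _ => ?_)
    · simp only [Finset.mem_filter, Finset.mem_univ, true_and, mem_fiberStabilizer]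
      constructor
      · intro h a
        have h1 := hrow (g⁻¹ (σ (g (τ⁻¹ a))))
        have h2 := hrow (τ⁻¹ a)
        simp at h1 h2
        simp [MulAut.conj_apply, ← h1, ← h2, h]
      · intro h a
        have h1 := hrow (g⁻¹ (σ a))
        have h2 := hrow (g⁻¹ a)
        have h3 := h (τ (g⁻¹ a))
        simp [MulAut.conj_apply] at h1 h2 h3
        rw [h1, h2, h3]
    · simp only [← Module.End.mul_apply, ← map_mul]
      congr 2
      simp [MulAut.conj_apply, mul_assoc]
  have hτv := (signTwist_eq_self_iff ρ τ v).1 (hC τ hτ)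
  rw [key, hτv, map_smul, ha, smul_zero, map_zero]

/-- The relations pass to the quotient by this orbit span, where the row symmetrizer kills the image
of `v`; hence that image is zero. -/
theorem mem_orbitSpan_symSum [CharZero K]
    (hC : ∀ τ ∈ fiberStabilizer T.col, signTwist ρ τ v = v)
    (hR : ∀ y, ∀ j < T.col y, ∑ x with T.col x = j, ρ (swap x y) v = v) :
    v ∈ orbitSpan ρ (symSum ρ T.row v) := by
  set X := orbitSpan ρ (symSum ρ T.row v)
  have hX : ∀ g, X ≤ X.comap (ρ g) := fun g w hw => orbitSpan_stable g hw
  let ρ' := ρ.quotient X hX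
  have hmk : ∀ g x, X.mkQ (ρ g x) = ρ' g (X.mkQ x) := fun g x => rfl
  have h0 : X.mkQ v = 0 := by
    refine eq_zero_of_symSum_eq_zero (ρ := ρ') (T := T) (fun τ hτ => ?_) (fun y j hj => ?_) ?_
    · rw [← signTwist_map X.mkQ hmk, hC τ hτ]
    · have := congrArg X.mkQ (hR y j hj)
      rwa [map_sum] at this
    · rw [← symSum_map X.mkQ hmk]
      exact (Submodule.Quotient.mk_eq_zero X).2 self_mem_orbitSpan
  exact (Submodule.Quotient.mk_eq_zero X).1 h0

/-- Von Neumann's lemma: the column antisymmetrizer, a permutation, and the row symmetrizer compose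
to a multiple of the product of the two symmetrizers. -/
theorem exists_smul_symSum_symSum [CharZero K] (g : Perm A) (w : N) :
    ∃ c : K, symSum (signTwist ρ) T.col (ρ g (symSum ρ T.row w)) =
      c • symSum (signTwist ρ) T.col (symSum ρ T.row w) := by
  by_cases h0 : symSum (signTwist ρ) T.col (ρ g (symSum ρ T.row w)) = 0
  · exact ⟨0, by rw [h0, zero_smul]⟩
  -- When the product is nonzero, the rows moved by `g` meet each column at most once. By counting,
  -- `g` is then a column permutation times a row permutation, and each factor is absorbed up to
  -- sign.
  have hinj : ∀ x y, T.row (g⁻¹ x) = T.row (g⁻¹ y) → T.col x = T.col y → x = y := by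
    intro x y h1 h2
    by_contra hxy
    apply h0
    have h3 := symSum_signTwist_swap (ρ := ρ) hxy h2 (ρ g (symSum ρ T.row w))
    have h4 : ρ (swap x y) (ρ g (symSum ρ T.row w)) = ρ g (symSum ρ T.row w) := by
      rw [← rep_mul_apply, swap_mul_eq_mul_swap, rep_mul_apply,
        symSum_comp_left (swap_mem_fiberStabilizer h1)]
    rw [h4] at h3
    exact eq_zero_of_neg_eq_self K h3.symm
  have hsum : ∑ y, T.row (g⁻¹ y) = ∑ y, T.row y := Equiv.sum_comp g⁻¹ T.row
  obtain ⟨τ, hτ, hrow⟩ := T.exists_colSubgroup_of_sum_le (fun x => T.row (g⁻¹ x)) hinj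
    (by rw [hsum]; exact T.two_mul_sum_row_le)
  have hκ : τ * g ∈ fiberStabilizer T.row := by
    intro a
    have := hrow (g a)
    simpa using this.symm
  have hg : g = τ⁻¹ * (τ * g) := by simp
  have hτ' : τ⁻¹ ∈ fiberStabilizer T.col := T.colSubgroup.inv_mem hτ
  refine ⟨(((Perm.sign τ⁻¹ : ℤˣ) : ℤ) : K), ?_⟩
  rw [hg, map_mul, Module.End.mul_apply, symSum_comp_left hκ,
    ← symSum_comp_right hτ' (symSum ρ T.row w), signTwist_apply, map_smul, sign_smul_sign_smul]

/-- A vector on which the column subgroup acts by the sign, and which satisfies the exchange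
relations of the tableau, is a multiple of its image under the transposed Young symmetrizer. -/
theorem exists_eq_smul_symSum_symSum [CharZero K]
    (hC : ∀ τ ∈ fiberStabilizer T.col, signTwist ρ τ v = v)
    (hR : ∀ y, ∀ j < T.col y, ∑ x with T.col x = j, ρ (swap x y) v = v) :
    ∃ c : K, v = c • symSum (signTwist ρ) T.col (symSum ρ T.row v) := by
  obtain ⟨m, hm, h⟩ := symSum_of_invariant hC
  have hm' : (m : K) ≠ 0 := by exact_mod_cast hm.ne'
  have : ∃ c : K, symSum (signTwist ρ) T.col v =
      c • symSum (signTwist ρ) T.col (symSum ρ T.row v) := by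
    refine orbitSpan_induction (p := fun x => ∃ c : K, symSum (signTwist ρ) T.col x =
      c • symSum (signTwist ρ) T.col (symSum ρ T.row v)) ⟨0, by simp⟩ ?_ ?_
      (fun g => exists_smul_symSum_symSum g v) (mem_orbitSpan_symSum hC hR)
    · rintro x y ⟨c, hc⟩ ⟨d, hd⟩
      exact ⟨c + d, by rw [map_add, hc, hd, add_smul]⟩
    · rintro d x ⟨c, hc⟩
      exact ⟨d * c, by rw [map_smul, hc, mul_smul]⟩
  obtain ⟨c, hc⟩ := this
  refine ⟨(m : K)⁻¹ * c, ?_⟩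
  rw [mul_smul, ← hc, h, inv_smul_smul₀ hm']

end Cyclic

/-! ### Polytabloids and their Garnir and exchange relations. -/

section PolytabloidRelations

open Equiv

variable (K : Type*) [Field K] {A B : Type*}

/-- Permutations of the entries acting on formal sums of bijections. -/
noncomputable def leftRep : Representation K (Perm A) ((B ≃ A) →₀ K) where
  toFun σ := Finsupp.lmapDomain K K fun α => α.trans σ
  map_one' := Finsupp.lmapDomain_id K K
  map_mul' σ τ := by
    ext α : 2
    simp [Perm.mul_def, Equiv.trans_assoc]

/-- Permutations of the positions acting on formal sums of bijections. -/
noncomputable def rightRep : Representation K (Perm B) ((B ≃ A) →₀ K) where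
  toFun σ := Finsupp.lmapDomain K K fun α => σ.symm.trans α
  map_one' := Finsupp.lmapDomain_id K K
  map_mul' σ τ := by
    ext α : 2
    simp [Perm.mul_def, Equiv.trans_assoc]

variable {K}

theorem leftRep_single (σ : Perm A) (α : B ≃ A) (c : K) :
    leftRep K σ (Finsupp.single α c) = Finsupp.single (α.trans σ) c := by
  exact Finsupp.mapDomain_single

theorem rightRep_single (σ : Perm B) (α : B ≃ A) (c : K) :
    rightRep K σ (Finsupp.single α c) = Finsupp.single (σ.symm.trans α) c := by
  exact Finsupp.mapDomain_single

theorem rightRep_leftRep (σ : Perm B) (τ : Perm A) (x : (B ≃ A) →₀ K) :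
    rightRep K σ (leftRep K τ x) = leftRep K τ (rightRep K σ x) := by
  induction x using Finsupp.induction_linear with
  | zero => simp
  | add x y hx hy => simp only [map_add, hx, hy]
  | single α c => simp only [leftRep_single, rightRep_single, Equiv.trans_assoc]

variable [Fintype A]

theorem rightRep_symSum_left [Fintype B] [DecidableEq B] {β γ : Type*} (r : B → β) (s : A → γ)
    (x : (B ≃ A) →₀ K) :
    symSum (signTwist (rightRep K)) r (symSum (leftRep K) s x) =
      symSum (leftRep K) s (symSum (signTwist (rightRep K)) r x) := by
  refine symSum_map _ (fun σ y => ?_) x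
  exact (symSum_map (leftRep K σ) (signTwist_map _ fun τ z => (rightRep_leftRep τ σ z).symm) y).symm

variable {lam : YoungDiagram} (T : Tableau lam A)

theorem card_filter_col_comp [Fintype B] (α : B ≃ A) (j : ℕ) :
    (Finset.univ.filter fun i => T.col (α i) = j).card = lam.colLen j := by
  rw [← T.card_filter_col j]
  exact Finset.card_equiv α fun i => by simp

variable [DecidableEq A]

variable (K) in
/-- The Young symmetrizer of `T` applied to the bijection `α`. -/
noncomputable def polytabloid (α : B ≃ A) : (B ≃ A) →₀ K :=
  symSum (leftRep K) T.row (symSum (signTwist (leftRep K)) T.col (Finsupp.single α 1))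

theorem rightRep_polytabloid (σ : Perm B) (α : B ≃ A) :
    rightRep K σ (polytabloid K T α) = polytabloid K T (σ.symm.trans α) := by
  rw [polytabloid, symSum_map _ (rightRep_leftRep σ),
    symSum_map _ (signTwist_map _ (rightRep_leftRep σ)), rightRep_single, polytabloid]

variable [Fintype B] [DecidableEq B]

/-- Transported through `α`, the inverse of `σ` is a column permutation of the entries, which the
column antisymmetrizer absorbs up to sign. -/
theorem signTwist_polytabloid {α : B ≃ A} {σ : Perm B}
    (hσ : σ ∈ fiberStabilizer fun i => T.col (α i)) :
    signTwist (rightRep K) σ (polytabloid K T α) = polytabloid K T α := by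
  rw [signTwist_eq_self_iff, rightRep_polytabloid]
  let κ : Perm A := (α.symm.trans σ.symm).trans α
  have hκ : κ ∈ fiberStabilizer T.col := by
    intro a
    have := (fiberStabilizer fun i => T.col (α i)).inv_mem hσ (α.symm a)
    simp only [apply_symm_apply] at this
    exact this
  have hs : Perm.sign κ = Perm.sign σ := by
    rw [Perm.sign_symm_trans_trans, Perm.sign_symm]
  have h1 : (Finsupp.single (σ.symm.trans α) 1 : (B ≃ A) →₀ K) =
      leftRep K κ (Finsupp.single α 1) := by
    rw [leftRep_single]
    congr 1
    ext i
    simp [κ]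
  have h2 := symSum_comp_right (ρ := signTwist (leftRep K)) hκ
    (Finsupp.single α 1 : (B ≃ A) →₀ K)
  rw [signTwist_apply, map_smul, hs] at h2
  rw [polytabloid, h1, polytabloid, ← h2, map_smul, sign_smul_sign_smul]

/-- A Garnir relation. -/
theorem symSum_polytabloid_eq_zero [CharZero K] {β : Type*} (r : B → β) (α : B ≃ A)
    (h : ∀ τ ∈ T.colSubgroup, ∃ i k, i ≠ k ∧ r i = r k ∧
      T.row (τ (α i)) = T.row (τ (α k))) :
    symSum (signTwist (rightRep K)) r (polytabloid K T α) = 0 := by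
  classical
  rw [polytabloid, rightRep_symSum_left, symSum_apply (signTwist (leftRep K)) T.col, map_sum,
    map_sum]
  refine Finset.sum_eq_zero fun τ hτ => ?_
  rw [signTwist_apply, map_smul, map_smul, leftRep_single]
  obtain ⟨i, k, hik, hr, hrow⟩ := h τ (Finset.mem_filter.1 hτ).2
  convert smul_zero _
  refine eq_zero_of_neg_eq_self K ?_
  -- Exchanging the positions `i` and `k` exchanges two entries of one row: the antisymmetrizer on
  -- positions changes sign, while the row symmetrizer does not.
  have h1 := symSum_signTwist_swap (ρ := rightRep K) hik hr (Finsupp.single (α.trans τ) 1)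
  have h2 : rightRep K (swap i k) (Finsupp.single (α.trans τ) 1) =
      leftRep K (swap (τ (α i)) (τ (α k))) (Finsupp.single (α.trans τ) 1) := by
    rw [rightRep_single, leftRep_single]
    congr 1
    ext x
    exact (α.trans τ).injective.map_swap i k x
  rw [← map_neg, ← h1, h2, ← rightRep_symSum_left, ← rightRep_symSum_left,
    symSum_comp_right (ρ := leftRep K) (swap_mem_fiberStabilizer hrow)]

/-- Pigeonhole: after any column permutation the block `d` still lies in columns from `j` on, which
have at most `lam.colLen j` rows. -/
theorem symSum_polytabloid_eq_zero_of_colLen_lt [CharZero K] {β : Type*} [DecidableEq β]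
    (r : B → β) (α : B ≃ A) (d : β) (j : ℕ) (hd : ∀ i, r i = d → j ≤ T.col (α i))
    (hcard : lam.colLen j < (Finset.univ.filter fun i => r i = d).card) :
    symSum (signTwist (rightRep K)) r (polytabloid K T α) = 0 := by
  refine symSum_polytabloid_eq_zero T r α fun τ hτ => ?_
  obtain ⟨i, hi, k, hk, hik, h⟩ := Finset.exists_ne_map_eq_of_card_lt_of_maps_to
    (s := Finset.univ.filter fun i => r i = d) (t := Finset.range (lam.colLen j))
    (f := fun i => T.row (τ (α i))) (by simpa using hcard) (fun i hi => by
      have h1 := YoungDiagram.mem_iff_lt_colLen.1 (T.row_col_mem (τ (α i)))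
      rw [show T.col (τ (α i)) = T.col (α i) from hτ _] at h1
      have h2 := lam.colLen_anti j _ (hd i (by simpa using hi))
      simpa using h1.trans_le h2)
  simp only [Finset.mem_filter, Finset.mem_univ, true_and] at hi hk
  exact ⟨i, k, hik, hi.trans hk.symm, h⟩

/-- The sum of the exchanges of an entry with those of a column further left. -/
theorem sum_rightRep_swap_polytabloid [CharZero K] (α : B ≃ A) (y : B) (j : ℕ)
    (hj : j < T.col (α y)) :
    ∑ x with T.col (α x) = j, rightRep K (swap x y) (polytabloid K T α) = polytabloid K T α := by
  set e := polytabloid K T α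
  set r : B → ℕ := fun i => T.col (α i)
  set r' := Function.update r y j
  set ρ : Representation K (Perm B) ((B ≃ A) →₀ K) := signTwist (rightRep K)
  -- Antisymmetrizing over column `j` enlarged by `y` multiplies the signed exchange sum by `c`. It
  -- also absorbs each exchange and kills `e`, as the enlarged column is too long; so the sum is
  -- zero.
  have hu := exchange_sum_invariant ρ r y j
    (fun σ hσ => signTwist_polytabloid T hσ : ∀ σ ∈ _, ρ σ e = e)
  obtain ⟨c, hc, h⟩ := symSum_of_invariant hu
  have hg : symSum ρ r' e = 0 := by
    refine symSum_polytabloid_eq_zero_of_colLen_lt T r' α j j (fun i hi => ?_) ?_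
    · by_cases hiy : i = y
      · rw [hiy]; exact hj.le
      · rw [show r' i = r i from Function.update_of_ne hiy _ _] at hi
        exact hi.ge
    · rw [← card_filter_col_comp T α j]
      refine Finset.card_lt_card ⟨fun x hx => ?_, fun hsub => ?_⟩
      · simp only [Finset.mem_filter, Finset.mem_univ, true_and] at hx ⊢
        have hxy : x ≠ y := by rintro rfl; omega
        rw [show r' x = r x from Function.update_of_ne hxy _ _]
        exact hx
      · have := hsub (show y ∈ _ by simp [r'])
        simp only [Finset.mem_filter, Finset.mem_univ, true_and] at this
        omega
  rw [map_sum, Finset.sum_eq_zero, exchange_sum_eq ρ r y j hj.ne'] at h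
  · have h0 := (smul_eq_zero.1 h.symm).resolve_left (by exact_mod_cast hc.ne')
    rw [Finset.sum_congr rfl (g := fun x => - rightRep K (swap x y) e), Finset.sum_neg_distrib,
      add_neg_eq_zero] at h0
    · exact h0.symm
    · intro x hx
      refine signTwist_swap _ ?_ _
      rintro rfl
      exact hj.ne' (Finset.mem_filter.1 hx).2
  · intro x hx
    rw [symSum_comp_right, hg]
    refine swap_mem_fiberStabilizer ?_
    rw [(Finset.mem_filter.1 hx).2]
    simp

end PolytabloidRelations

/-! ### Straightening until the chosen positions fill a Young diagram. -/

section Straightening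

open Equiv

variable {K : Type*} [Field K] {A B : Type*} {lam : YoungDiagram} (T : Tableau lam A) (S : Finset B)

/-- The boxes of `T` filled by the positions in `S`. -/
def boxesOf (β : B ≃ A) : Set (ℕ × ℕ) := {c | ∃ i ∈ S, (T.symm (β i)).1 = c}

variable {T S} in
theorem isLowerSet_boxesOf {β : B ≃ A}
    (hV : ∀ i ∈ S, ∀ k, T.col (β k) = T.col (β i) → T.row (β k) < T.row (β i) → k ∈ S)
    (hH : ∀ i ∈ S, ∀ k, T.row (β k) = T.row (β i) → T.col (β i) = T.col (β k) + 1 → k ∈ S) :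
    IsLowerSet (boxesOf T S β) := by
  -- Iterating `hH` along a row reaches any box `d` steps to the left.
  have key : ∀ d : ℕ, ∀ i ∈ S, ∀ k, T.row (β k) = T.row (β i) →
      T.col (β i) = T.col (β k) + d → k ∈ S := by
    intro d
    induction d with
    | zero =>
      intro i hi k h1 h2
      have : k = i := β.injective (T.eq_of_row_col h1 h2.symm)
      exact this ▸ hi
    | succ d ih =>
      intro i hi k h1 h2
      have hm : (T.row (β k), T.col (β k) + d) ∈ lam.cells :=
        lam.up_left_mem h1.le (by omega) (T.row_col_mem (β i))
      refine ih (β.symm (T ⟨_, hm⟩)) (hH i hi _ ?_ ?_) k ?_ ?_ <;>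
        simp only [apply_symm_apply, T.row_apply, T.col_apply] <;> omega
  rintro _ ⟨a, b⟩ hle ⟨i, hi, rfl⟩
  have hle' : a ≤ T.row (β i) ∧ b ≤ T.col (β i) := hle
  have hm1 : (a, T.col (β i)) ∈ lam.cells := lam.up_left_mem hle'.1 le_rfl (T.row_col_mem (β i))
  have hm2 : (a, b) ∈ lam.cells := lam.up_left_mem hle'.1 hle'.2 (T.row_col_mem (β i))
  have h1 : β.symm (T ⟨_, hm1⟩) ∈ S := by
    rcases hle'.1.lt_or_eq with h | h
    · refine hV i hi _ ?_ ?_ <;> simp only [apply_symm_apply, T.row_apply, T.col_apply]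
      exact h
    · refine key 0 i hi _ ?_ ?_ <;> simp only [apply_symm_apply, T.row_apply, T.col_apply]
      · exact h
      · rfl
  refine ⟨β.symm (T ⟨_, hm2⟩), key (T.col (β i) - b) _ h1 _ ?_ ?_, ?_⟩
  · simp only [apply_symm_apply, T.row_apply]
  · simp only [apply_symm_apply, T.col_apply]; omega
  · simp

variable [Fintype A] [DecidableEq A]

variable (K) in
/-- The span of the polytabloids in which the positions in `S` fill a lower set of boxes and are
weakly to the left of their columns in `β`. -/
noncomputable def lowerSpan (β : B ≃ A) : Submodule K ((B ≃ A) →₀ K) :=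
  Submodule.span K {x | ∃ γ : B ≃ A, (∀ i ∈ S, T.col (γ i) ≤ T.col (β i)) ∧
    IsLowerSet (boxesOf T S γ) ∧ x = polytabloid K T γ}

variable {T S}

theorem lowerSpan_mono {β γ : B ≃ A} (h : ∀ i ∈ S, T.col (γ i) ≤ T.col (β i)) :
    lowerSpan K T S γ ≤ lowerSpan K T S β := by
  refine Submodule.span_mono ?_
  rintro x ⟨δ, h1, h2, rfl⟩
  exact ⟨δ, fun i hi => (h1 i hi).trans (h i hi), h2, rfl⟩

variable [CharZero K] [Fintype B] [DecidableEq B]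

/-- The Garnir relation of two adjacent boxes in a row, the right one of which is filled by a
position in `S`, the left one not, where the positions in `S` are at the top of their columns. -/
theorem polytabloid_mem_of_garnir {X : Submodule K ((B ≃ A) →₀ K)} {β : B ≃ A}
    (hV : ∀ i ∈ S, ∀ k, T.col (β k) = T.col (β i) → T.row (β k) < T.row (β i) → k ∈ S)
    {i k : B} (hi : i ∈ S) (hk : k ∉ S) (hrow : T.row (β k) = T.row (β i))
    (hcol : T.col (β i) = T.col (β k) + 1)
    (hX : ∀ γ : B ≃ A, (∀ l ∈ S, T.col (γ l) ≤ T.col (β l)) →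
      (∃ l ∈ S, T.col (γ l) < T.col (β l)) → polytabloid K T γ ∈ X) :
    polytabloid K T β ∈ X := by
  classical
  set R := T.row (β i)
  set j := T.col (β k)
  -- The Garnir belt: column `j` from row `R` downwards and column `j + 1` down to row `R`. It has
  -- one box more than column `j`, and by `hV` its positions in `S` are exactly those in column `j +
  -- 1`.
  let D : Finset B := Finset.univ.filter fun l =>
    (T.col (β l) = j ∧ R ≤ T.row (β l)) ∨ (T.col (β l) = j + 1 ∧ T.row (β l) ≤ R)
  have hD : ∀ l, l ∈ D ↔ (T.col (β l) = j ∧ R ≤ T.row (β l)) ∨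
      (T.col (β l) = j + 1 ∧ T.row (β l) ≤ R) := fun l => by simp [D]
  have hDS : ∀ l ∈ D, (l ∈ S ↔ T.col (β l) = j + 1) := by
    intro l hl
    rcases (hD l).1 hl with ⟨h1, h2⟩ | ⟨h1, h2⟩
    · refine ⟨fun hlS => ?_, fun h => by omega⟩
      exfalso
      rcases h2.lt_or_eq with h2 | h2
      · exact hk (hV l hlS k h1.symm (by omega))
      · have : l = k := β.injective (T.eq_of_row_col (h2.symm.trans hrow.symm) h1)
        exact hk (this ▸ hlS)
    · refine ⟨fun _ => h1, fun _ => ?_⟩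
      rcases h2.lt_or_eq with h2 | h2
      · exact hV i hi l (h1.trans hcol.symm) h2
      · have : l = i := β.injective (T.eq_of_row_col h2 (h1.trans hcol.symm))
        exact this ▸ hi
  let r : B → Option B := fun l => if l ∈ D then none else some l
  have hr : ∀ l, r l = none ↔ l ∈ D := fun l => by simp [r]
  have hg : symSum (signTwist (rightRep K)) r (polytabloid K T β) = 0 := by
    refine symSum_polytabloid_eq_zero_of_colLen_lt T r β none j (fun l hl => ?_) ?_
    · rcases (hD l).1 ((hr l).1 hl) with h | h <;> omega
    · simp only [hr]
      rw [← Nat.succ_le_iff, ← Finset.card_range (lam.colLen j).succ]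
      -- Column `j + 1` covers 0, …, `R`; column `j`, shifted by one, covers `R + 1`, …, `lam.colLen
      -- j`.
      refine Finset.card_le_card_of_surjOn
        (fun l => if T.col (β l) = j then T.row (β l) + 1 else T.row (β l)) ?_
      intro t ht
      simp only [Finset.coe_range, Set.mem_Iio] at ht
      by_cases htR : t ≤ R
      · have hm : (t, j + 1) ∈ lam.cells := lam.up_left_mem htR hcol.ge (T.row_col_mem (β i))
        refine ⟨β.symm (T ⟨(t, j + 1), hm⟩), ?_, ?_⟩
        · simp [hD, T.row_apply, T.col_apply, htR]
        · simp [T.row_apply, T.col_apply]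
      · have hm : (t - 1, j) ∈ lam.cells := YoungDiagram.mem_iff_lt_colLen.2 (by omega)
        refine ⟨β.symm (T ⟨(t - 1, j), hm⟩), ?_, ?_⟩
        · simp [hD, T.row_apply, T.col_apply]; omega
        · simp [T.row_apply, T.col_apply]; omega
  have hfix : ∀ σ ∈ fiberStabilizer r, ∀ l, l ∉ D → σ l = l := by
    intro σ hσ l hl
    have h1 := hσ l
    have h2 : σ l ∉ D := by rwa [← hr, h1, hr]
    simpa [r, hl, h2] using h1
  have hstab : ∀ σ ∈ fiberStabilizer r, ∀ l, l ∈ D → σ l ∈ D := by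
    intro σ hσ l hl
    rw [← hr, hσ l, hr]; exact hl
  have hcolD : ∀ l ∈ D, T.col (β l) ≤ j + 1 := fun l hl => by
    rcases (hD l).1 hl with h | h <;> omega
  -- The column-preserving terms all equal the given polytabloid, and their number is invertible.
  -- The remaining terms have to lie in `X`.
  rw [symSum_apply, ← Finset.sum_filter_add_sum_filter_not _
    (fun σ => σ ∈ fiberStabilizer fun l => T.col (β l)),
    Finset.sum_congr rfl (g := fun _ => polytabloid K T β), Finset.sum_const] at hg
  · rw [← Nat.cast_smul_eq_nsmul K, ← eq_neg_iff_add_eq_zero] at hg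
    refine (Submodule.smul_mem_iff X ?_).1 (Set.mem_of_eq_of_mem hg
      (X.neg_mem (Submodule.sum_mem _ fun σ hσ => ?_)))
    · refine Nat.cast_ne_zero.2 (Finset.card_pos.2 ⟨1, ?_⟩).ne'
      simp [one_mem]
    simp only [Finset.mem_filter, Finset.mem_univ, true_and] at hσ
    obtain ⟨hσr, hσc⟩ := hσ
    have hσr' := (fiberStabilizer r).inv_mem hσr
    rw [signTwist_apply, rightRep_polytabloid]
    have hle : ∀ l ∈ S, T.col (β (σ⁻¹ l)) ≤ T.col (β l) := by
      intro l hl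
      by_cases hlD : l ∈ D
      · rw [(hDS l hlD).1 hl]
        exact hcolD _ (hstab _ hσr' l hlD)
      · rw [hfix _ hσr' l hlD]
    refine X.smul_mem _ (hX _ hle ?_)
    -- If nothing in `S` moved strictly left, `σ⁻¹` would map `D ∩ S` onto itself, hence also the
    -- rest of `D`, and would preserve all columns.
    by_contra! hge
    have heq : ∀ l ∈ S, T.col (β (σ⁻¹ l)) = T.col (β l) := fun l hl =>
      (hle l hl).antisymm (hge l hl)
    apply hσc
    rw [← inv_mem_iff]
    have hY : ∀ l ∈ D ∩ S, σ⁻¹ l ∈ D ∩ S := by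
      intro l hl
      rw [Finset.mem_inter] at hl ⊢
      have h1 := hstab _ hσr' l hl.1
      exact ⟨h1, (hDS _ h1).2 ((heq l hl.2).trans ((hDS l hl.1).1 hl.2))⟩
    have hY' : (D ∩ S).image (σ⁻¹ : Perm B) = D ∩ S := by
      refine Finset.eq_of_subset_of_card_le ?_ ?_
      · intro x hx
        obtain ⟨l, hl, rfl⟩ := Finset.mem_image.1 hx
        exact hY l hl
      · rw [Finset.card_image_of_injective _ (σ⁻¹).injective]
    intro l
    show T.col (β (σ⁻¹ l)) = T.col (β l)
    by_cases hlS : l ∈ S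
    · exact heq l hlS
    by_cases hlD : l ∈ D
    · have h1 := hstab _ hσr' l hlD
      have h2 : σ⁻¹ l ∉ S := by
        intro h2
        have h3 := Finset.mem_inter.2 ⟨h1, h2⟩
        rw [← hY', Finset.mem_image] at h3
        obtain ⟨l', hl', h4⟩ := h3
        rw [(σ⁻¹).injective h4] at hl'
        exact hlS (Finset.mem_inter.1 hl').2
      have h5 := (hDS l hlD).not.1 hlS
      have h6 := (hDS _ h1).not.1 h2
      rcases (hD l).1 hlD with h | h <;> rcases (hD _).1 h1 with h' | h' <;> omega
    · rw [hfix _ hσr' l hlD]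
  · intro σ hσ
    exact signTwist_polytabloid T (Finset.mem_filter.1 hσ).2

/-- Induction on the column sum of `S`, then on its row sum. A position of `S` below one outside `S`
is exchanged within the column, which costs a sign and lowers the row sum; otherwise a Garnir
relation lowers the column sum. -/
theorem polytabloid_mem_lowerSpan (β : B ≃ A) : polytabloid K T β ∈ lowerSpan K T S β := by
  induction hs : ∑ i ∈ S, T.col (β i) using Nat.strong_induction_on generalizing β with
  | _ s ihs =>
  induction ht : ∑ i ∈ S, T.row (β i) using Nat.strong_induction_on generalizing β with
  | _ t iht =>
  by_cases hV : ∀ i ∈ S, ∀ k, T.col (β k) = T.col (β i) → T.row (β k) < T.row (β i) → k ∈ S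
  · by_cases hH : ∀ i ∈ S, ∀ k, T.row (β k) = T.row (β i) → T.col (β i) = T.col (β k) + 1 → k ∈ S
    · exact Submodule.subset_span ⟨β, fun _ _ => le_rfl, isLowerSet_boxesOf hV hH, rfl⟩
    · push Not at hH
      obtain ⟨i, hi, k, h1, h2, hk⟩ := hH
      refine polytabloid_mem_of_garnir hV hi hk h1 h2 fun γ hγ hlt => ?_
      refine lowerSpan_mono hγ (ihs _ ?_ γ rfl)
      rw [← hs]
      exact Finset.sum_lt_sum hγ hlt
  · push Not at hV
    obtain ⟨i, hi, k, h1, h2, hk⟩ := hV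
    have hik : i ≠ k := by rintro rfl; exact hk hi
    set γ : B ≃ A := (swap i k).trans β
    have hcol : ∀ l, T.col (γ l) = T.col (β l) :=
      swap_mem_fiberStabilizer (r := fun l => T.col (β l)) h1.symm
    have he : polytabloid K T β = - polytabloid K T γ := by
      have h3 := signTwist_polytabloid (K := K) T
        (swap_mem_fiberStabilizer (r := fun l => T.col (β l)) h1.symm)
      rw [signTwist_swap _ hik, rightRep_polytabloid, symm_swap] at h3
      exact h3.symm
    rw [he]
    refine neg_mem (lowerSpan_mono (fun l _ => (hcol l).le) (iht _ ?_ γ ?_ rfl))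
    · rw [← ht]
      refine Finset.sum_lt_sum (fun l hl => ?_) ⟨i, hi, by simpa [γ] using h2⟩
      by_cases hli : l = i
      · subst hli; simpa [γ] using h2.le
      · have hlk : l ≠ k := by rintro rfl; exact hk hl
        simp [γ, swap_apply_of_ne_of_ne hli hlk]
    · rw [← hs]
      exact Finset.sum_congr rfl fun l _ => hcol l

end Straightening

/-! ### The first k positions: reduction to the tableau they form. -/

section InitialPositions

open Equiv

variable {k m : ℕ}

/-- The permutations of the first `k` positions, as permutations of all positions. -/
def embPerm (k m : ℕ) : Perm (Fin k) →* Perm (Fin (k + m)) :=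
  (finSumFinEquiv (m := k) (n := m)).permCongrHom.toMonoidHom.comp
    ((Perm.sumCongrHom (Fin k) (Fin m)).comp (MonoidHom.inl _ _))

theorem embPerm_castAdd (σ : Perm (Fin k)) (i : Fin k) :
    embPerm k m σ (Fin.castAdd m i) = Fin.castAdd m (σ i) := by
  simp [embPerm, Equiv.permCongrHom, Equiv.permCongr_apply]

theorem embPerm_natAdd (σ : Perm (Fin k)) (i : Fin m) :
    embPerm k m σ (Fin.natAdd k i) = Fin.natAdd k i := by
  simp [embPerm, Equiv.permCongrHom, Equiv.permCongr_apply]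

theorem sign_embPerm (σ : Perm (Fin k)) : Perm.sign (embPerm k m σ) = Perm.sign σ := by
  simp [embPerm, Equiv.permCongrHom]

theorem embPerm_swap (x y : Fin k) :
    embPerm k m (swap x y) = swap (Fin.castAdd m x) (Fin.castAdd m y) := by
  ext i
  congr 1
  induction i using Fin.addCases with
  | left i => rw [embPerm_castAdd, (Fin.castAdd_injective k m).map_swap]
  | right i =>
    rw [embPerm_natAdd, swap_apply_of_ne_of_ne] <;>
    · intro h
      have := congrArg Fin.val h
      simp at this
      omega

variable {K : Type*} [Field K] {A : Type*}

/-- Permutations of the first `k` positions acting on formal sums of bijections. -/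
noncomputable def initialRep (K : Type*) [Field K] (m : ℕ) (A : Type*) (k : ℕ) :
    Representation K (Perm (Fin k)) ((Fin (k + m) ≃ A) →₀ K) :=
  (rightRep K).comp (embPerm k m)

theorem initialRep_apply (σ : Perm (Fin k)) (x : (Fin (k + m) ≃ A) →₀ K) :
    initialRep K m A k σ x = rightRep K (embPerm k m σ) x := rfl

theorem signTwist_initialRep (σ : Perm (Fin k)) (x : (Fin (k + m) ≃ A) →₀ K) :
    signTwist (initialRep K m A k) σ x = signTwist (rightRep K) (embPerm k m σ) x := by
  rw [signTwist_apply, signTwist_apply, sign_embPerm, initialRep_apply]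

variable {lam : YoungDiagram} (T : Tableau lam A)

/-- The sum of the column indices of the boxes filled by the first `k` positions. -/
def colSum (β : Fin (k + m) ≃ A) : ℕ := ∑ i : Fin k, T.col (β (Fin.castAdd m i))

theorem colSum_embPerm (σ : Perm (Fin k)) (β : Fin (k + m) ≃ A) :
    colSum T ((embPerm k m σ).trans β) = colSum T β := by
  simp only [colSum, trans_apply, embPerm_castAdd]
  exact Equiv.sum_comp σ fun i => T.col (β (Fin.castAdd m i))

variable {T} in
/-- Exchanging one of the first `k` positions with a position further right does not increase
the sum of the columns. -/
theorem colSum_swap_le {β : Fin (k + m) ≃ A} {x : Fin (k + m)} {y : Fin k}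
    (h : T.col (β x) ≤ T.col (β (Fin.castAdd m y))) :
    colSum T ((swap x (Fin.castAdd m y)).trans β) ≤ colSum T β := by
  induction x using Fin.addCases with
  | left x => rw [← embPerm_swap, colSum_embPerm]
  | right x =>
    refine Finset.sum_le_sum fun i _ => ?_
    have h1 : Fin.castAdd m i ≠ Fin.natAdd k x := by
      intro h
      have := congrArg Fin.val h
      simp at this
      omega
    by_cases hi : i = y
    · subst hi; simpa using h
    · rw [trans_apply, swap_apply_of_ne_of_ne h1 (by simpa [Fin.castAdd_inj] using hi)]

variable {T} in
theorem colSum_swap_natAdd_lt {β : Fin (k + m) ≃ A} {x : Fin m} {y : Fin k}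
    (h : T.col (β (Fin.natAdd k x)) < T.col (β (Fin.castAdd m y))) :
    colSum T ((swap (Fin.natAdd k x) (Fin.castAdd m y)).trans β) < colSum T β := by
  refine Finset.sum_lt_sum (fun i _ => ?_) ⟨y, Finset.mem_univ y, by simpa using h⟩
  have h1 : Fin.castAdd m i ≠ Fin.natAdd k x := by
    intro h
    have := congrArg Fin.val h
    simp at this
    omega
  by_cases hi : i = y
  · subst hi; simpa using h.le
  · rw [trans_apply, swap_apply_of_ne_of_ne h1 (by simpa [Fin.castAdd_inj] using hi)]

variable [Fintype A] [DecidableEq A]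

theorem initialRep_polytabloid (σ : Perm (Fin k)) (β : Fin (k + m) ≃ A) :
    initialRep K m A k σ (polytabloid K T β) = polytabloid K T ((embPerm k m σ⁻¹).trans β) := by
  rw [initialRep_apply, rightRep_polytabloid, map_inv]
  rfl

variable (K) in
/-- The span of the antisymmetrized polytabloids in which the positions labelled by less than `l`
are weakly to the left of the column given by their label. -/
noncomputable def labelledSpan (c : Fin k → ℕ) (l s : ℕ) :
    Submodule K ((Fin (k + m) ≃ A) →₀ K) :=
  Submodule.span K {x | ∃ γ : Fin (k + m) ≃ A,
    (∀ i, c i < l → T.col (γ (Fin.castAdd m i)) ≤ c i) ∧ colSum T γ ≤ s ∧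
    x = symSum (signTwist (initialRep K m A k)) c (polytabloid K T γ)}

variable {T}

theorem labelledSpan_mono {c : Fin k → ℕ} {l s t : ℕ} (h : s ≤ t) :
    labelledSpan (m := m) K T c l s ≤ labelledSpan K T c l t := by
  refine Submodule.span_mono ?_
  rintro x ⟨γ, h1, h2, rfl⟩
  exact ⟨γ, h1, h2.trans h, rfl⟩

variable (K T) in
/-- The span of the polytabloids in which the first `k` positions have a smaller column sum
than in `φ`. -/
noncomputable def smallerSpan (φ : Fin (k + m) ≃ A) : Submodule K ((Fin (k + m) ≃ A) →₀ K) :=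
  Submodule.span K {x | ∃ γ : Fin (k + m) ≃ A, colSum T γ < colSum T φ ∧ x = polytabloid K T γ}

theorem smallerSpan_stable (φ : Fin (k + m) ≃ A) (σ : Perm (Fin k)) :
    smallerSpan K T φ ≤ (smallerSpan K T φ).comap (initialRep K m A k σ) := by
  refine Submodule.span_le.2 ?_
  rintro x ⟨γ, h, rfl⟩
  rw [SetLike.mem_coe, Submodule.mem_comap, initialRep_polytabloid]
  exact Submodule.subset_span ⟨_, by rwa [colSum_embPerm], rfl⟩

variable {mu : YoungDiagram} {F : Tableau mu (Fin k)} {φ : Fin (k + m) ≃ A}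

theorem signTwist_initialRep_polytabloid
    (hF : ∀ i, F.col i = T.col (φ (Fin.castAdd m i))) {σ : Perm (Fin k)}
    (hσ : σ ∈ fiberStabilizer F.col) :
    signTwist (initialRep K m A k) σ (polytabloid K T φ) = polytabloid K T φ := by
  rw [signTwist_initialRep, signTwist_polytabloid]
  intro i
  induction i using Fin.addCases with
  | left i => simp only [embPerm_castAdd, ← hF]; exact hσ i
  | right i => rw [embPerm_natAdd]

variable [CharZero K]

/-- Induction on the number of positions labelled `l` to the right of column `l`. Exchange such a
position `y` with column `l`: partners labelled `l` only change the sign after antisymmetrization,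
so they move to the other side with a positive coefficient. Every other exchange repairs `y`, and it
displaces no label below `l`, because those lie left of column `l`. -/
theorem symSum_polytabloid_mem_labelledSpan_succ (c : Fin k → ℕ) (l : ℕ) (β : Fin (k + m) ≃ A)
    (hβ : ∀ i, c i < l → T.col (β (Fin.castAdd m i)) ≤ c i) :
    symSum (signTwist (initialRep K m A k)) c (polytabloid K T β) ∈
      labelledSpan K T c (l + 1) (colSum T β) := by
  classical
  induction hq : (Finset.univ.filter fun i => c i = l ∧ l < T.col (β (Fin.castAdd m i))).card
    using Nat.strong_induction_on generalizing β with
  | _ q ih =>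
  by_cases hy : ∃ y, c y = l ∧ l < T.col (β (Fin.castAdd m y))
  swap
  · push Not at hy
    refine Submodule.subset_span ⟨β, fun i hi => ?_, le_rfl, rfl⟩
    rcases (Nat.lt_succ_iff.1 hi).lt_or_eq with h | h
    · exact hβ i h
    · rw [h]; exact hy i h
  obtain ⟨y, hcy, hly⟩ := hy
  set b := symSum (signTwist (initialRep K m A k)) c
  have hex := congrArg b (sum_rightRep_swap_polytabloid (K := K) T β (Fin.castAdd m y) l hly)
  rw [map_sum, ← Finset.sum_filter_add_sum_filter_not _
    (fun x => ∃ i : Fin k, x = Fin.castAdd m i ∧ c i = l),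
    Finset.sum_congr rfl (g := fun _ => -b (polytabloid K T β)), Finset.sum_const] at hex
  · have h1 : ∀ (p : ℕ) (e f : (Fin (k + m) ≃ A) →₀ K), p • -e + f = e →
        ((p + 1 : ℕ) : K) • e = f := by
      intro p e f h
      rw [Nat.cast_smul_eq_nsmul, add_smul, one_smul]
      nth_rewrite 2 [← h]
      simp
    refine (Submodule.smul_mem_iff _ (Nat.cast_ne_zero.2 (Nat.succ_ne_zero _))).1
      (Set.mem_of_eq_of_mem (h1 _ _ _ hex) (Submodule.sum_mem _ fun x hx => ?_))
    simp only [Finset.mem_filter, Finset.mem_univ, true_and, not_exists, not_and] at hx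
    obtain ⟨hxl, hx⟩ := hx
    rw [rightRep_polytabloid, symm_swap]
    have hne : ∀ i, c i = l → Fin.castAdd m i ≠ x := fun i hi h => hx i h.symm hi
    refine labelledSpan_mono (colSum_swap_le (hxl.trans_le hly.le)) (ih _ ?_ _ ?_ rfl)
    · rw [← hq]
      refine Finset.card_lt_card ⟨fun i hi => ?_, fun hsub => ?_⟩
      · simp only [Finset.mem_filter, Finset.mem_univ, true_and] at hi ⊢
        refine ⟨hi.1, ?_⟩
        by_cases hiy : i = y
        · rw [hiy]; exact hly
        · have := hi.2
          rwa [trans_apply, swap_apply_of_ne_of_ne (hne i hi.1)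
            (by simpa [Fin.castAdd_inj] using hiy)] at this
      · have := hsub (show y ∈ _ by simp [hcy, hly])
        rw [Finset.mem_filter, trans_apply, swap_apply_right, hxl] at this
        exact lt_irrefl _ this.2.2
    · intro i hi
      have hiy : i ≠ y := by rintro rfl; omega
      by_cases hix : Fin.castAdd m i = x
      · have := hβ i hi
        rw [hix] at this
        omega
      · rw [trans_apply, swap_apply_of_ne_of_ne hix (by simpa [Fin.castAdd_inj] using hiy)]
        exact hβ i hi
  · intro x hx
    simp only [Finset.mem_filter, Finset.mem_univ, true_and] at hx
    obtain ⟨hxl, i, rfl, hi⟩ := hx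
    have hiy : i ≠ y := by rintro rfl; omega
    rw [← embPerm_swap, ← initialRep_apply]
    exact symSum_signTwist_swap hiy (hi.trans hcy.symm) _

theorem symSum_polytabloid_mem_labelledSpan (c : Fin k → ℕ) (l : ℕ) (β : Fin (k + m) ≃ A) :
    symSum (signTwist (initialRep K m A k)) c (polytabloid K T β) ∈
      labelledSpan K T c l (colSum T β) := by
  induction l with
  | zero => exact Submodule.subset_span ⟨β, by simp, le_rfl, rfl⟩
  | succ l ih =>
    refine Submodule.span_le.2 ?_ ih
    rintro x ⟨γ, h1, h2, rfl⟩
    exact labelledSpan_mono h2 (symSum_polytabloid_mem_labelledSpan_succ c l γ h1)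

/-- The antisymmetrization of a polytabloid along the columns of a tableau with entries in the first
`k` positions is spanned by polytabloids in which no such position is to the right of its column. -/
theorem symSum_polytabloid_mem_span (c : Fin k → ℕ) (β : Fin (k + m) ≃ A) :
    symSum (signTwist (initialRep K m A k)) c (polytabloid K T β) ∈
      Submodule.span K {x | ∃ γ : Fin (k + m) ≃ A, (∀ i, T.col (γ (Fin.castAdd m i)) ≤ c i) ∧
        colSum T γ ≤ colSum T β ∧ x = polytabloid K T γ} := by
  classical
  -- `∑ i, c i + 1` exceeds every label, so all the first `k` positions are controlled. Expanding
  -- the antisymmetrizer keeps the bounds, since its permutations preserve labels.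
  refine Submodule.span_le.2 ?_
    (symSum_polytabloid_mem_labelledSpan (K := K) c (∑ i, c i + 1) β)
  rintro x ⟨γ, h1, h2, rfl⟩
  rw [SetLike.mem_coe, symSum_apply]
  refine Submodule.sum_mem _ fun σ hσ => ?_
  rw [signTwist_apply, initialRep_polytabloid]
  refine Submodule.smul_mem _ _ (Submodule.subset_span ⟨_, fun i => ?_, ?_, rfl⟩)
  · have hc : c (σ⁻¹ i) = c i :=
      (fiberStabilizer c).inv_mem (Finset.mem_filter.1 hσ).2 i
    rw [trans_apply, embPerm_castAdd, ← hc]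
    exact h1 _ (Nat.lt_succ_iff.2 (Finset.single_le_sum (f := c) (fun _ _ => Nat.zero_le _)
      (Finset.mem_univ _)))
  · rwa [colSum_embPerm]

/-- Modulo polytabloids with a smaller column sum, a polytabloid is a multiple of its image under the
transposed Young symmetrizer of the tableau of the first `k` positions. -/
theorem exists_sub_smul_mem_smallerSpan
    (hF : ∀ i, F.col i = T.col (φ (Fin.castAdd m i))) :
    ∃ c : K, polytabloid K T φ - c • symSum (signTwist (initialRep K m A k)) F.col
      (symSum (initialRep K m A k) F.row (polytabloid K T φ)) ∈ smallerSpan K T φ := by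
  set W := smallerSpan K T φ
  let ρ := (initialRep K m A k).quotient W (smallerSpan_stable φ)
  have hmk : ∀ g x, W.mkQ (initialRep K m A k g x) = ρ g (W.mkQ x) := fun g x => rfl
  set v := W.mkQ (polytabloid K T φ) with hv
  have hC : ∀ τ ∈ fiberStabilizer F.col, signTwist ρ τ v = v := by
    intro τ hτ
    rw [hv, ← signTwist_map W.mkQ hmk, signTwist_initialRep_polytabloid hF hτ]
  have hR : ∀ y, ∀ j < F.col y, ∑ x with F.col x = j, ρ (swap x y) v = v := by
    intro y j hj
    rw [hF] at hj
    have h := congrArg W.mkQ (sum_rightRep_swap_polytabloid (K := K) T φ (Fin.castAdd m y) j hj)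
    -- Exchanges with positions beyond the first `k` lower the column sum and vanish modulo `W`;
    -- what remains is the exchange relation of `F`.
    rw [Finset.sum_filter, Fin.sum_univ_add, map_add, ← Finset.sum_filter, ← Finset.sum_filter,
      map_sum W.mkQ _ (Finset.univ.filter fun i => T.col (φ (Fin.natAdd k i)) = j),
      Finset.sum_eq_zero (s := Finset.univ.filter fun i => T.col (φ (Fin.natAdd k i)) = j),
      add_zero, map_sum] at h
    · simp only [hv, ← hmk, hF, initialRep_apply, embPerm_swap]
      exact h
    · intro x hx
      rw [rightRep_polytabloid, symm_swap]
      refine (Submodule.Quotient.mk_eq_zero W).2 (Submodule.subset_span ⟨_, ?_, rfl⟩)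
      exact colSum_swap_natAdd_lt ((Finset.mem_filter.1 hx).2.trans_lt hj)
  obtain ⟨c, hc⟩ := exists_eq_smul_symSum_symSum hC hR
  refine ⟨c, (Submodule.Quotient.mk_eq_zero W).1 ?_⟩
  rw [hv, ← symSum_map W.mkQ hmk, ← symSum_map W.mkQ (signTwist_map W.mkQ hmk), ← map_smul] at hc
  rw [← Submodule.mkQ_apply, map_sub, sub_eq_zero]
  exact hc

/-- A polytabloid lies in the image of the transposed Young symmetrizer of the tableau of the first
`k` positions, up to polytabloids in which these positions fill a Young diagram and are moved to
the left. -/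
theorem exists_sub_mem_span_leftMoves
    (hF : ∀ i, F.col i = T.col (φ (Fin.castAdd m i))) :
    ∃ x, polytabloid K T φ - symSum (signTwist (initialRep K m A k)) F.col
      (symSum (initialRep K m A k) F.row x) ∈
        Submodule.span K {x | ∃ γ : Fin (k + m) ≃ A,
          (∀ i, T.col (γ (Fin.castAdd m i)) ≤ T.col (φ (Fin.castAdd m i))) ∧
          (∃ i, T.col (γ (Fin.castAdd m i)) < T.col (φ (Fin.castAdd m i))) ∧
          IsLowerSet (boxesOf T (Finset.univ.map (Fin.castAddEmb m)) γ) ∧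
          x = polytabloid K T γ} := by
  set X := Submodule.span K {x | ∃ γ : Fin (k + m) ≃ A,
          (∀ i, T.col (γ (Fin.castAdd m i)) ≤ T.col (φ (Fin.castAdd m i))) ∧
          (∃ i, T.col (γ (Fin.castAdd m i)) < T.col (φ (Fin.castAdd m i))) ∧
          IsLowerSet (boxesOf T (Finset.univ.map (Fin.castAddEmb m)) γ) ∧
          x = polytabloid K T γ}
  set b := symSum (signTwist (initialRep K m A k)) F.col
  set y := symSum (initialRep K m A k) F.row (polytabloid K T φ)
  obtain ⟨c, hc⟩ := exists_sub_smul_mem_smallerSpan (K := K) hF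
  obtain ⟨p, hp, hpb⟩ := symSum_of_invariant (ρ := signTwist (initialRep K m A k))
    (fun σ (hσ : σ ∈ fiberStabilizer F.col) => signTwist_initialRep_polytabloid (K := K) hF hσ)
  obtain ⟨q, -, hqb⟩ := symSum_of_invariant (ρ := signTwist (initialRep K m A k))
    (fun σ (hσ : σ ∈ fiberStabilizer F.col) => symSum_comp_left hσ y)
  have hb : ∀ w ∈ smallerSpan K T φ, b w ∈ X := by
    suffices h : smallerSpan K T φ ≤ X.comap b from fun w hw => h hw
    refine Submodule.span_le.2 ?_
    rintro _ ⟨β, hβ, rfl⟩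
    rw [SetLike.mem_coe, Submodule.mem_comap]
    refine Submodule.span_le.2 ?_ (symSum_polytabloid_mem_span (K := K) F.col β)
    rintro _ ⟨γ, h1, h2, rfl⟩
    refine Submodule.span_le.2 ?_
      (polytabloid_mem_lowerSpan (K := K) (T := T) (S := Finset.univ.map (Fin.castAddEmb m)) γ)
    rintro _ ⟨δ, h3, h4, rfl⟩
    have h5 : ∀ i, T.col (δ (Fin.castAdd m i)) ≤ T.col (γ (Fin.castAdd m i)) := fun i =>
      h3 _ (Finset.mem_map_of_mem (Fin.castAddEmb m) (Finset.mem_univ i))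
    refine Submodule.subset_span ⟨δ, fun i => (h5 i).trans (hF i ▸ h1 i), ?_, h4, rfl⟩
    -- If no position moved strictly left, the column sum of `γ` would be at least that of `φ`, but
    -- it is at most that of `β`, which is smaller.
    by_contra! hge
    have h6 : colSum T φ ≤ colSum T γ := Finset.sum_le_sum fun i _ => (hge i).trans (h5 i)
    omega
  have hp' : (p : K) ≠ 0 := Nat.cast_ne_zero.2 hp.ne'
  -- Obtained by applying `p⁻¹ b` to the relation `hc`: `b` multiplies the polytabloid by `p` and `b
  -- y` by `q`.
  refine ⟨((p : K)⁻¹ * (c * q)) • polytabloid K T φ, ?_⟩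
  have h := X.smul_mem (p : K)⁻¹ (hb _ hc)
  have e : (p : K)⁻¹ • b (polytabloid K T φ - c • b y) =
      polytabloid K T φ - ((p : K)⁻¹ * (c * q)) • b y := by
    rw [map_sub, map_smul, show b (polytabloid K T φ) = _ from hpb, show b (b y) = _ from hqb,
      smul_sub, inv_smul_smul₀ hp', smul_smul, smul_smul, mul_assoc]
  rw [map_smul, map_smul]
  exact e ▸ h

end InitialPositions

/-! ### Translation to ideals of the generic tensor algebra. -/

section Ideals

open Equiv

variable {K : Type v} [Field K]

theorem inv_permCongr_mem_iff {A B β : Type*} (s : A → β) (α : B ≃ A) (σ : Perm A) :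
    (α.symm.permCongr σ)⁻¹ ∈ fiberStabilizer (fun i => s (α i)) ↔ σ ∈ fiberStabilizer s := by
  rw [inv_mem_iff]
  constructor
  · intro h a
    simpa using h (α.symm a)
  · intro h i
    simpa using h (α i)

/-- Conjugation by `α` turns permutations of entries into permutations of positions; the inverse
appears because positions act by precomposition with the inverse. -/
theorem symSum_leftRep_single {A B β : Type*} [Fintype A] [Fintype B] (s : A → β) (α : B ≃ A) :
    symSum (leftRep K) s (Finsupp.single α 1) =
      symSum (rightRep K) (fun i => s (α i)) (Finsupp.single α 1) := by
  classical
  rw [symSum_apply, symSum_apply]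
  refine Finset.sum_equiv (α.symm.permCongr.trans (Equiv.inv _)) (fun σ => ?_) (fun σ _ => ?_)
  · simp only [Finset.mem_filter, Finset.mem_univ, true_and]
    exact (inv_permCongr_mem_iff s α σ).symm
  · rw [leftRep_single, rightRep_single]
    congr 1
    ext i
    simp [← Perm.inv_def]

theorem symSum_signTwist_leftRep_single {A B β : Type*} [Fintype A] [Fintype B] [DecidableEq A]
    [DecidableEq B] (s : A → β) (α : B ≃ A) :
    symSum (signTwist (leftRep K)) s (Finsupp.single α 1) =
      symSum (signTwist (rightRep K)) (fun i => s (α i)) (Finsupp.single α 1) := by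
  classical
  rw [symSum_apply, symSum_apply]
  refine Finset.sum_equiv (α.symm.permCongr.trans (Equiv.inv _)) (fun σ => ?_) (fun σ _ => ?_)
  · simp only [Finset.mem_filter, Finset.mem_univ, true_and]
    exact (inv_permCongr_mem_iff s α σ).symm
  · rw [signTwist_apply, signTwist_apply, leftRep_single, rightRep_single]
    congr 2
    · simp
    · ext i
      simp [← Perm.inv_def]

variable (K) in
/-- The inclusion of the formal sums of bijections from `Fin n` in the generic tensor algebra. -/
noncomputable def toTensor (n : ℕ) (A : Type u) : ((Fin n ≃ A) →₀ K) →ₗ[K] TensorSpace K A :=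
  Finsupp.lmapDomain K K fun α => ⟨n, α⟩

theorem toTensor_single {n : ℕ} {A : Type u} (α : Fin n ≃ A) :
    toTensor K n A (Finsupp.single α 1) = z K α :=
  Finsupp.mapDomain_single

theorem toTensor_leftRep {n : ℕ} {A : Type u} (σ : Perm A) (x : (Fin n ≃ A) →₀ K) :
    toTensor K n A (leftRep K σ x) = permRep K A σ (toTensor K n A x) := by
  induction x using Finsupp.induction_linear with
  | zero => simp
  | add x y hx hy => simp only [map_add, hx, hy]
  | single α c =>
    have h : (Finsupp.single α c : (Fin n ≃ A) →₀ K) = c • Finsupp.single α 1 := by simp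
    rw [h, map_smul, map_smul, map_smul, map_smul, leftRep_single, toTensor_single,
      toTensor_single]
    exact congrArg (c • ·) (mapT_z K σ α).symm

theorem asAlgebraHom_rowSymmetrizer {A N : Type*} [AddCommGroup N] [Module K N] [Fintype A]
    {lam : YoungDiagram} (T : Tableau lam A) (ρ : Representation K (Perm A) N) (x : N) :
    ρ.asAlgebraHom (T.rowSymmetrizer K) x = symSum ρ T.row x := by
  classical
  simp only [Tableau.rowSymmetrizer, map_sum, LinearMap.sum_apply, symSum_apply]
  refine Finset.sum_congr ?_ fun σ _ => ?_
  · ext σ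
    simp only [Finset.mem_filter, Finset.mem_univ, true_and]
    exact Iff.rfl
  · rw [Representation.asAlgebraHom_of]

theorem asAlgebraHom_colAntisymmetrizer {A N : Type*} [AddCommGroup N] [Module K N] [Fintype A]
    [DecidableEq A] {lam : YoungDiagram} (T : Tableau lam A)
    (ρ : Representation K (Perm A) N) (x : N) :
    ρ.asAlgebraHom (T.colAntisymmetrizer K) x = symSum (signTwist ρ) T.col x := by
  classical
  simp only [Tableau.colAntisymmetrizer, map_sum, LinearMap.sum_apply, symSum_apply]
  refine Finset.sum_congr ?_ fun σ _ => ?_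
  · ext σ
    simp only [Finset.mem_filter, Finset.mem_univ, true_and]
    exact Iff.rfl
  · rw [map_smul, LinearMap.smul_apply, Representation.asAlgebraHom_of, signTwist_apply]
    congr!

theorem tabloidElement_eq {n : ℕ} {A : Type u} [Fintype A] [DecidableEq A] {lam : YoungDiagram}
    (G : Tableau lam (Fin n)) (T : Tableau lam A) :
    tabloidElement K G T = toTensor K n A (polytabloid K T (G.symm.trans T)) := by
  rw [polytabloid, symSum_map _ toTensor_leftRep, symSum_map _ (signTwist_map _ toTensor_leftRep),
    toTensor_single, tabloidElement, Tableau.youngSymmetrizer, map_mul, Module.End.mul_apply,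
    asAlgebraHom_rowSymmetrizer, asAlgebraHom_colAntisymmetrizer]

/-- Extends a bijection from the first `k` positions by the remaining values of `α`. -/
noncomputable def extendFirst {k m : ℕ} {A C : Type*} (u : C ≃ Fin k) (α : Fin (k + m) ≃ A) :
    ((Fin k ≃ C) →₀ K) →ₗ[K] ((Fin (k + m) ≃ A) →₀ K) :=
  Finsupp.lmapDomain K K fun γ => Equiv.trans (embPerm k m (γ.trans u)) α

theorem extendFirst_single {k m : ℕ} {A C : Type*} (u : C ≃ Fin k) (α : Fin (k + m) ≃ A)
    (γ : Fin k ≃ C) (c : K) : extendFirst u α (Finsupp.single γ c) =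
      Finsupp.single (Equiv.trans (embPerm k m (γ.trans u)) α) c :=
  Finsupp.mapDomain_single

theorem extendFirst_rightRep {k m : ℕ} {A C : Type*} (u : C ≃ Fin k) (α : Fin (k + m) ≃ A)
    (σ : Perm (Fin k)) (x : (Fin k ≃ C) →₀ K) :
    extendFirst u α (rightRep K σ x) = initialRep K m A k σ (extendFirst u α x) := by
  induction x using Finsupp.induction_linear with
  | zero => simp
  | add x y hx hy => simp only [map_add, hx, hy]
  | single γ c =>
    rw [rightRep_single, extendFirst_single, extendFirst_single, initialRep_apply,
      rightRep_single]
    congr 1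
    have : (σ.symm.trans γ).trans u = (γ.trans u : Perm (Fin k)) * σ⁻¹ := rfl
    rw [this, map_mul, map_inv]
    rfl

/-- Extending by fixed remaining values is multiplication on the right by a basis vector followed by
a relabelling, and ideals are stable under both. -/
theorem toTensor_extendFirst {k m : ℕ} {A C D : Type u} (u : C ≃ Fin k) (w : D ≃ Fin m)
    (α : Fin (k + m) ≃ A) (x : (Fin k ≃ C) →₀ K) :
    toTensor K (k + m) A (extendFirst u α x) =
      mapT K (((sumCongr u w).trans finSumFinEquiv).trans α)
        (mulT K (toTensor K k C x) (z K w.symm)) := by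
  induction x using Finsupp.induction_linear with
  | zero => simp
  | add x y hx hy => simp only [map_add, hx, hy, LinearMap.add_apply]
  | single γ c =>
    have h : (Finsupp.single γ c : (Fin k ≃ C) →₀ K) = c • Finsupp.single γ 1 := by simp
    rw [h, map_smul, map_smul, map_smul, map_smul, LinearMap.smul_apply, map_smul,
      extendFirst_single, toTensor_single, toTensor_single, mulT_z, mapT_z]
    congr 2
    ext i
    induction i using Fin.addCases with
    | left i => simp [embPerm_castAdd]
    | right i => simp [embPerm_natAdd]

/-- The image of the transposed Young symmetrizer of a tableau with entries in the first `k` positions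
lies in the ideal generated by its tabloid. -/
theorem toTensor_symSum_mem {k m : ℕ} {mu : YoungDiagram} (F : Tableau mu (Fin k))
    {A : Type u} [Finite A] (x : (Fin (k + m) ≃ A) →₀ K) :
    toTensor K (k + m) A (symSum (signTwist (initialRep K m A k)) F.col
      (symSum (initialRep K m A k) F.row x)) ∈
      (GenericIdeal.generatedBy.{u, v} (tabloid K F)).carrier A := by
  classical
  induction x using Finsupp.induction_linear with
  | zero => simp
  | add x y hx hy => simp only [map_add]; exact add_mem hx hy
  | single α c =>
    have h : (Finsupp.single α c : (Fin (k + m) ≃ A) →₀ K) = c • Finsupp.single α 1 := by simp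
    rw [h, map_smul, map_smul, map_smul]
    refine Submodule.smul_mem _ _ ?_
    -- The entries are lifted because the ideal is indexed by sets in universe `u`.
    let u : ULift.{u} (Fin k) ≃ Fin k := Equiv.ulift
    let T : Tableau mu (ULift.{u} (Fin k)) := F.trans u.symm
    have hT : F.symm.trans T = u.symm := by ext i; simp [T]
    have key : symSum (signTwist (initialRep K m A k)) F.col (symSum (initialRep K m A k) F.row
        (Finsupp.single α 1)) = extendFirst u α (polytabloid K T u.symm) := by
      -- Passing from entries to positions reverses the order of the two symmetrizers: the row
      -- symmetrizer on entries commutes with the antisymmetrizer on positions.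
      rw [polytabloid, symSum_signTwist_leftRep_single, ← rightRep_symSum_left,
        symSum_leftRep_single, symSum_map _ (signTwist_map _ (extendFirst_rightRep (K := K) u α)),
        symSum_map (extendFirst (K := K) u α) (extendFirst_rightRep u α), extendFirst_single]
      have h1 : (fun i => T.col (u.symm i)) = F.col := rfl
      have h2 : (fun i => T.row (u.symm i)) = F.row := rfl
      have h3 : Equiv.trans (embPerm k m (u.symm.trans u)) α = α := by
        rw [symm_trans_self, ← Perm.one_def, map_one]
        rfl
      rw [h1, h2, h3]
    rw [key, toTensor_extendFirst u (Equiv.ulift : ULift.{u} (Fin m) ≃ Fin m)]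
    refine GenericIdeal.map_mem _ _ (GenericIdeal.mul_mem _ _ ?_)
    refine GenericIdeal.generatedBy_contains _ _ ⟨T, ?_⟩
    rw [tabloidElement_eq, hT]

theorem generatedBy_mono {E E' : Elements.{u} K} (h : ∀ (A : Type u) [Finite A], E A ⊆ E' A)
    (A : Type u) [Finite A] :
    (GenericIdeal.generatedBy E).carrier A ≤ (GenericIdeal.generatedBy E').carrier A :=
  GenericIdeal.generatedBy_le E _
    (fun A _ => (h A).trans (GenericIdeal.generatedBy_contains E' A)) A

theorem add_carrier (I J : GenericIdeal.{u} K) (A : Type u) [Finite A] :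
    (I + J).carrier A = I.carrier A ⊔ J.carrier A := rfl

theorem mem_leftMoves_of_isLowerSet {k m : ℕ} {lam : YoungDiagram} {A : Type u} {T : Tableau lam A}
    {F : Tableau lam (Fin (k + m))} {γ : Fin (k + m) ≃ A}
    (h1 : ∀ i, T.col (γ (Fin.castAdd m i)) ≤ F.col (Fin.castAdd m i))
    (h2 : ∃ i, T.col (γ (Fin.castAdd m i)) < F.col (Fin.castAdd m i))
    (h3 : IsLowerSet (boxesOf T (Finset.univ.map (Fin.castAddEmb m)) γ)) :
    T.trans γ.symm ∈ leftMoves F k := by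
  classical
  refine ⟨fun i hi => h1 ⟨i, hi⟩, ?_, ?_⟩
  · obtain ⟨i, hi⟩ := h2
    exact ⟨Fin.castAdd m i, i.2, hi⟩
  · have hsub : boxesOf T (Finset.univ.map (Fin.castAddEmb m)) γ ⊆ lam.cells := by
      rintro _ ⟨i, -, rfl⟩
      exact (T.symm (γ i)).2
    refine ⟨⟨lam.cells.filter (· ∈ boxesOf T (Finset.univ.map (Fin.castAddEmb m)) γ), ?_⟩,
      ?_, ?_⟩
    · rw [Finset.coe_filter]
      convert h3 using 1
      ext c
      exact ⟨fun h => h.2, fun h => ⟨hsub h, h⟩⟩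
    · rw [← YoungDiagram.cells_subset_iff]
      exact Finset.filter_subset _ _
    · ext c
      simp only [Finset.coe_filter]
      constructor
      · rintro ⟨hc, hlt⟩
        refine ⟨hc, γ.symm (T ⟨c, hc⟩), ?_, by simp⟩
        exact Finset.mem_map.2 ⟨⟨_, hlt⟩, Finset.mem_univ _, rfl⟩
      · rintro ⟨hc, i, hi, h⟩
        refine ⟨hc, ?_⟩
        obtain ⟨j, -, rfl⟩ := Finset.mem_map.1 hi
        have : (⟨c, hc⟩ : {c // c ∈ lam.cells}) = T.symm (γ (Fin.castAddEmb m j)) :=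
          Subtype.ext h.symm
        simp [this]

variable [CharZero K]

theorem contains_tabloid_of_leftMoves {n k : ℕ} (hkn : k ≤ n) {lam mu : YoungDiagram}
    (F : Tableau lam (Fin n)) (hF : F.initialBoxes k = (mu.cells : Set (ℕ × ℕ))) :
    (GenericIdeal.generatedBy.{u, v} (tabloid K (F.restrict hkn hF)) +
      GenericIdeal.generatedBy.{u, v} (tabloids K (leftMoves F k))).Contains (tabloid K F) := by
  obtain ⟨m, rfl⟩ := Nat.exists_eq_add_of_le hkn
  rintro A _ _ ⟨T, rfl⟩
  let _ := Fintype.ofFinite A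
  let _ := Classical.decEq A
  have hcol : ∀ i, T.col ((F.symm.trans T) i) = F.col i := fun i => by
    simp [Tableau.col]
  obtain ⟨x, hx⟩ := exists_sub_mem_span_leftMoves (K := K) (T := T) (φ := F.symm.trans T)
    (F := F.restrict hkn hF) (fun i => (hcol _).symm)
  rw [tabloidElement_eq, SetLike.mem_coe, add_carrier]
  set y := symSum (signTwist (initialRep K m A k)) (F.restrict hkn hF).col
      (symSum (initialRep K m A k) (F.restrict hkn hF).row x)
  rw [← add_sub_cancel y (polytabloid K T (F.symm.trans T)), map_add]
  refine Submodule.add_mem_sup (toTensor_symSum_mem _ x) ?_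
  rw [← Submodule.mem_comap]
  refine Submodule.span_le.2 ?_ hx
  rintro _ ⟨γ, h1, h2, h3, rfl⟩
  simp only [hcol] at h1 h2
  refine GenericIdeal.generatedBy_contains _ _ ⟨_, mem_leftMoves_of_isLowerSet h1 h2 h3, T, ?_⟩
  rw [tabloidElement_eq]
  congr 2
  ext i
  simp

/-- Induction on the column sum of the first `k` entries. Each `G` in `leftMoves F k` has a smaller
sum, its restricted tabloid is among the generators, and its own left moves are again left moves of
`F`. -/
theorem contains_tabloid_of_restrictedTabloids {n k : ℕ} (hkn : k ≤ n) {lam mu : YoungDiagram}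
    (F : Tableau lam (Fin n)) (hF : F.initialBoxes k = (mu.cells : Set (ℕ × ℕ))) :
    (GenericIdeal.generatedBy.{u, v} (tabloid K (F.restrict hkn hF)) +
      GenericIdeal.generatedBy.{u, v} (restrictedTabloids K hkn (leftMoves F k))).Contains
        (tabloid K F) := by
  induction hs : ∑ i ∈ Finset.univ.filter (fun i : Fin n => (i : ℕ) < k), F.col i
    using Nat.strong_induction_on generalizing F mu with
  | _ s ih =>
  intro A _ x hx
  have hcontains : (GenericIdeal.generatedBy.{u, v} (tabloid K (F.restrict hkn hF)) +
      GenericIdeal.generatedBy.{u, v} (restrictedTabloids K hkn (leftMoves F k))).Contains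
        (tabloids K (leftMoves F k)) := by
    rintro B _ y ⟨G, hG, hy⟩
    obtain ⟨hle, ⟨i, hik, hi⟩, δ, -, hδ⟩ := id hG
    have hlt : ∑ i ∈ Finset.univ.filter (fun i : Fin n => (i : ℕ) < k), G.col i < s := by
      rw [← hs]
      exact Finset.sum_lt_sum (fun i hi => hle i (Finset.mem_filter.1 hi).2)
        ⟨i, by simpa using hik, hi⟩
    refine SetLike.le_def.1 (sup_le ?_ ?_) (ih _ hlt G hδ rfl B hy)
    · refine le_sup_of_le_right (generatedBy_mono (fun C _ w hw => ?_) B)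
      exact ⟨G, hG, δ, hδ, hw⟩
    · refine le_sup_of_le_right (generatedBy_mono (fun C _ w hw => ?_) B)
      obtain ⟨H, ⟨h1, ⟨j, hjk, hj⟩, h3⟩, h4⟩ := hw
      exact ⟨H, ⟨fun l hl => (h1 l hl).trans (hle l hl), ⟨j, hjk, hj.trans_le (hle j hjk)⟩, h3⟩, h4⟩
  exact SetLike.le_def.1 (sup_le le_sup_left (GenericIdeal.generatedBy_le _ _ hcontains A))
    (contains_tabloid_of_leftMoves hkn F hF A hx)

end Ideals

end GenericTensor

theorem mainTheorem4 {K : Type v} [Field K] [CharZero K] {n k : ℕ} (hk0 : 0 < k)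
    (hkn : k ≤ n) (lam mu : YoungDiagram) (hlam : lam.card = n) (hmu : mu.card = k)
    (hmulam : mu ≤ lam) (F : GenericTensor.Tableau lam (Fin n))
    (hF : F.initialBoxes k = (mu.cells : Set (ℕ × ℕ))) :
    (GenericTensor.GenericIdeal.generatedBy.{u, v}
          (GenericTensor.tabloid K (F.restrict hkn hF)) +
        GenericTensor.GenericIdeal.generatedBy.{u, v}
          (GenericTensor.tabloids K (GenericTensor.leftMoves F k))).Contains
      (GenericTensor.tabloid K F) ∧
    (GenericTensor.GenericIdeal.generatedBy.{u, v}
          (GenericTensor.tabloid K (F.restrict hkn hF)) +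
        GenericTensor.GenericIdeal.generatedBy.{u, v}
          (GenericTensor.restrictedTabloids K hkn (GenericTensor.leftMoves F k))).Contains
      (GenericTensor.tabloid K F) :=
  ⟨GenericTensor.contains_tabloid_of_leftMoves hkn F hF,
    GenericTensor.contains_tabloid_of_restrictedTabloids hkn F hF⟩
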